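/- Let $a\in(\tfrac12,\tfrac23]$, $p\in(0,1)$, $q=1-p$. Let $\xi_1,\xi_2,\dots$ be i.i.d. with $\mathbb P(\xi_1=1)=p$, $\mathbb P(\xi_1=-1)=q$, and let $X_0=x$, $X_{n+1}=aX_n+\xi_{n+1}$ for $n\ge0$, and $\tau=\inf\{n\ge0:X_n<0\}$; write $\mathbb E_x$ for the expectation when the starting point is $x$. Put $I_a=\big(\tfrac{2a-1}{1-a},1\big)$ and define $T_a$ on $[0,\tfrac1{1-a}]\setminus I_a$ by $T_a(x)=\tfrac1a(x+1)$ for $0\le x\le\tfrac{2a-1}{1-a}$ and $T_a(x)=\tfrac1a(x-1)$ for $1\le x\le\tfrac1{1-a}$, with $T_{2/3}(1)=0$. For $x\in[0,\tfrac1{1-a}]$ let $\varkappa_a(x)=\inf\{k\ge0:T_a^k(x)\in I_a\}\in\{0,1,2,\dots\}\cup\{\infty\}$ and, for integers $0\le k\le\varkappa_a(x)$, let $\delta_k(x)=\mathbb 1\{T_a^k(x)<1\}$ and $L_k(x)=\sum_{i=0}^{k-1}\delta_i(x)$. There is a unique $\lambda_a>0$ with $$\sum_{k=0}^{\varkappa_a(0)}\delta_k(0)\Big(\frac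 p{\lambda_a}\Big)^{k+1}\Big(\frac qp\Big)^{L_k(0)}=1,$$ and there is a (necessarily unique) probability measure $\nu_a$ on $[0,\tfrac1{1-a}]$ with $$\nu_a([0,y])=1-\sum_{k=0}^{\varkappa_a(y)}\delta_k(y)\Big(\frac p{\lambda_a}\Big)^{k+1}\Big(\frac qp\Big)^{L_k(y)},\qquad y\in\big[0,\tfrac1{1-a}\big],$$ where all the series converge. Moreover, there exist constants $C>0$ and $\gamma_1\in(0,1)$, depending only on $a$ and $p$, such that for every function $f$ of bounded variation on $[0,\tfrac1{1-a}]$, every $x\in[0,\tfrac1{1-a}]$ and every integer $n\ge0$, $$\Big|\mathbb E_x\big(f(X_n)\mid\tau>n\big)-\int_0^{1/(1-a)}f\,d\nu_a\Big|\le C\gamma_1^n\,\mathrm{Var}[f],$$ where $\mathrm{Var}[f]$ is the total variation of $f$ on $[0,\tfrac1{1-a}]$. -/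

import Mathlib

open MeasureTheory ProbabilityTheory Set

noncomputable section

namespace ARPersist

/-- The AR(1) chain `X₀ = x`, `X_{n+1} = a X_n + ξ_{n+1}`, along one realisation `ξ` of the
innovations (the entry `ξ 0` is not used). -/
def chain (a x : ℝ) (ξ : ℕ → ℝ) : ℕ → ℝ
  | 0 => x
  | n + 1 => a * chain a x ξ n + ξ (n + 1)

/-- The exit time `τ = inf {n ≥ 0 : X_n < 0}`, equal to `⊤` if the chain never becomes negative. -/
def exitTime (a x : ℝ) (ξ : ℕ → ℝ) : ℕ∞ :=
  ⨅ (n : ℕ) (_ : chain a x ξ n < 0), (n : ℕ∞)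

/-- The `ξ n`, `n ≥ 1`, are i.i.d. under `P` with
`P (ξ n = 1) = p` and `P (ξ n = -1) = 1 - p`. -/
structure IsInnovation {Ω : Type*} [MeasurableSpace Ω] (P : Measure Ω) (p : ℝ)
    (ξ : ℕ → Ω → ℝ) : Prop where
  measurable : ∀ n, 1 ≤ n → Measurable (ξ n)
  indep : iIndepFun (fun n : ℕ => ξ (n + 1)) P
  prob_one : ∀ n, 1 ≤ n → P {ω | ξ n ω = 1} = ENNReal.ofReal p
  prob_neg_one : ∀ n, 1 ≤ n → P {ω | ξ n ω = -1} = ENNReal.ofReal (1 - p)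

/-- The state space `[0, 1/(1-a)]`. -/
def stateSpace (a : ℝ) : Set ℝ := Icc 0 (1 / (1 - a))

/-- The hole `I_a = ((2a-1)/(1-a), 1)`, where the map `T_a` is not defined. -/
def hole (a : ℝ) : Set ℝ := Ioo ((2 * a - 1) / (1 - a)) 1

/-- The map `T_a`: it is `(x+1)/a` for `0 ≤ x ≤ (2a-1)/(1-a)` and `(x-1)/a` for
`1 ≤ x ≤ 1/(1-a)`, with `T_a(1) = 0` when `a = 2/3`. The values at points of the hole are
never used: orbits are only followed up to their first visit to the hole. -/
def T (a x : ℝ) : ℝ := if x < 1 then (x + 1) / a else (x - 1) / a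

/-- `ϰ_a(x) = inf {k ≥ 0 : T_a^k(x) ∈ I_a}`, possibly `⊤`. -/
def kappa (a x : ℝ) : ℕ∞ :=
  ⨅ (k : ℕ) (_ : (T a)^[k] x ∈ hole a), (k : ℕ∞)

open scoped Classical in
/-- `δ_k(x) = 1{T_a^k(x) < 1}`. -/
def delta (a x : ℝ) (k : ℕ) : ℕ := if (T a)^[k] x < 1 then 1 else 0

/-- The occupation time `L_k(x) = δ_0(x) + ⋯ + δ_{k-1}(x)`. -/
def occ (a x : ℝ) (k : ℕ) : ℕ := ∑ i ∈ Finset.range k, delta a x i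

open scoped Classical in
/-- The `k`-th term of `∑_{k=0}^{ϰ_a(x)} δ_k(x) (p/lam)^{k+1} (q/p)^{L_k(x)}`, `q = 1 - p`,
set to `0` for `k > ϰ_a(x)`. -/
def term (a p lam x : ℝ) (k : ℕ) : ℝ :=
  if (k : ℕ∞) ≤ kappa a x then
    (delta a x k : ℝ) * (p / lam) ^ (k + 1) * ((1 - p) / p) ^ (occ a x k)
  else 0

/-- `lam` is a positive solution of `∑_{k=0}^{ϰ_a} δ_k (p/lam)^{k+1} (q/p)^{L_k} = 1`, where
`ϰ_a, δ_k, L_k` are taken at the point `0`. -/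
def IsRate (a p lam : ℝ) : Prop := 0 < lam ∧ HasSum (term a p lam 0) 1

/-- `ν` is the probability measure on `[0, 1/(1-a)]` with distribution function
`y ↦ 1 - ∑_{k=0}^{ϰ_a(y)} δ_k(y) (p/lam)^{k+1} (q/p)^{L_k(y)}`, the series being convergent. -/
structure IsLimitLaw (a p lam : ℝ) (ν : Measure ℝ) : Prop where
  prob : IsProbabilityMeasure ν
  carrier : ν (stateSpace a)ᶜ = 0
  summable : ∀ y ∈ stateSpace a, Summable (term a p lam y)
  distribution : ∀ y ∈ stateSpace a, ν.real (Iic y) = 1 - ∑' k, term a p lam y k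

end ARPersist

end

/-! Write Q for the operator `killed`, S_n = Q^n 1 for `survival`, c_k(y) for `coef` and W_n(y) for
`pathWeight`. Because a ≤ 2/3, Q sends a tail indicator to a constant plus a multiple of one tail
indicator: Q 1_{(y,∞)} = δ_0(y) p + w(y) 1_{(Ty,∞)}, where w is 0 on the hole, q elsewhere below 1,
and p from 1 on (`killed_indicator_Ioi`). Iterating gives Q^n 1_{(y,∞)} = Σ_{k<n} c_k(y) S_{n-1-k} +
W_n(y) 1_{(T^n y,∞)} (`killed_iterate_expansion`). With closed half-lines and y = 0 this becomes a
renewal equation for S_n(x) whose kernel c_k(0) does not depend on x (`survival_eq`).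

Let z be the supremum of the points where the power series of S_n(1/(1-a)) converges; then λ = 1/z.
Comparing generating functions bounds Σ c_k(y) z^{k+1} by 1 for every y. Since W is a multiplicative
cocycle, the resulting uniform summability improves to W_n(y) z^n ≤ A ρ^n with ρ < 1. So the series
for y = 0 converges beyond z, and its value at z must be 1: otherwise the renewal equation would
make the survival series converge beyond z (`exists_critical`).

Now b_k = c_k(0) z^{k+1} is a probability sequence with exponential tails and b_0 > 0, so its
renewal sequence has exponentially small increments and a positive lower bound
(`renewal_exponential`). Both properties pass to S_n(x) z^n, uniformly in x, and dividing the
expansion by S_n(x) gives convergence of the conditional tails to Σ c_k(y) z^{k+1}, exponentially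
fast and uniformly in x and y (`exists_uniform_convergence`).

The uniform limit defines ν (`exists_limitLaw`), the uniform bound on tails controls integrals of
functions of bounded variation (`abs_integral_sub_le_of_boundedVariationOn`), and
`IsInnovation.integral_alive` connects Q^n with the chain. -/

noncomputable section

namespace ARPersist

open Filter Topology

/-! ### Renewal theorem with exponential rate -/

/-- A power series with nonnegative coefficients of total mass one, the first of them positive,
takes the value `1` on the closed unit disc only at `1`. -/
theorem eq_one_of_tsum_mul_pow_eq_one {b : ℕ → ℝ} (hb : ∀ k, 0 ≤ b k) (hb0 : 0 < b 0)
    (hs : HasSum b 1) {z : ℂ} (hz : ‖z‖ ≤ 1)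
    (h : HasSum (fun k => (b k : ℂ) * z ^ (k + 1)) 1) : z = 1 := by
  have hre : HasSum (fun k => b k * (z ^ (k + 1)).re) 1 := by
    simpa [Complex.re_ofReal_mul] using Complex.hasSum_re h
  have hle : ∀ k, (z ^ (k + 1)).re ≤ 1 := fun k =>
    (Complex.re_le_norm _).trans (by rw [norm_pow]; exact pow_le_one₀ (norm_nonneg _) hz)
  -- The nonnegative terms b_k (1 - Re z^{k+1}) sum to 0, so all vanish; k = 0 with b_0 > 0 forces
  -- Re z = 1.
  have hd : HasSum (fun k => b k * (1 - (z ^ (k + 1)).re)) 0 := by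
    simpa [mul_sub] using hs.sub hre
  have h0 := (hasSum_zero_iff_of_nonneg (fun k => mul_nonneg (hb k) (sub_nonneg.2 (hle k)))).1 hd
  have h1 : z.re = 1 := by
    have := congrFun h0 0
    simp only [zero_add, pow_one, Pi.zero_apply, mul_eq_zero] at this
    rcases this with h | h <;> linarith
  have h2 : z.re ^ 2 + z.im ^ 2 ≤ 1 := by
    have := Complex.sq_norm z
    rw [Complex.normSq_apply] at this
    nlinarith [norm_nonneg z]
  have h3 : z.im = 0 := by
    rw [h1] at h2
    exact pow_eq_zero_iff (two_ne_zero) |>.1 (le_antisymm (by linarith) (sq_nonneg _))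
  exact Complex.ext h1 h3

/-- A power series with exponentially decaying coefficients is holomorphic on a disc that is
larger than the unit disc. -/
theorem differentiableOn_tsum_mul_pow {d : ℕ → ℝ} {C ρ R : ℝ} (hρ : 0 ≤ ρ) (hR : 0 ≤ R)
    (hρR : ρ * R < 1) (hd : ∀ k, |d k| ≤ C * ρ ^ k) :
    DifferentiableOn ℂ (fun z : ℂ => ∑' k, (d k : ℂ) * z ^ k) (Metric.ball 0 R) := by
  refine Complex.differentiableOn_tsum_of_summable_norm (u := fun k => C * (ρ * R) ^ k)
    ((summable_geometric_of_lt_one (mul_nonneg hρ hR) hρR).mul_left C) ?_ Metric.isOpen_ball ?_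
  · intro k
    fun_prop
  · intro k z hz
    rw [norm_mul, norm_pow, Complex.norm_real, Real.norm_eq_abs, mul_pow, ← mul_assoc]
    have : ‖z‖ ≤ R := by simpa using (Metric.mem_ball.1 hz).le
    have h0 : 0 ≤ C * ρ ^ k := (abs_nonneg _).trans (hd k)
    gcongr
    exact hd k

/-- If a power series with exponentially decaying coefficients has no zero on the closed unit disc,
then the coefficients of its reciprocal decay exponentially. -/
theorem exists_abs_le_of_convolution_eq_single {d s : ℕ → ℝ} {C ρ B : ℝ} (hρ : 0 < ρ)
    (hρ1 : ρ < 1) (hd : ∀ k, |d k| ≤ C * ρ ^ k) (hsB : ∀ k, |s k| ≤ B)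
    (hne : ∀ z : ℂ, ‖z‖ ≤ 1 → ∑' k, (d k : ℂ) * z ^ k ≠ 0)
    (hds : ∀ n, ∑ k ∈ Finset.range (n + 1), d k * s (n - k) = if n = 0 then 1 else 0) :
    ∃ K γ : ℝ, 0 < γ ∧ γ < 1 ∧ ∀ n, |s n| ≤ K * γ ^ n := by
  set D : ℂ → ℂ := fun z => ∑' k, (d k : ℂ) * z ^ k with hD
  obtain ⟨R₁, hR₁, hρR⟩ : ∃ R₁ : ℝ, 1 < R₁ ∧ ρ * R₁ < 1 := by
    refine ⟨(1 + 1 / ρ) / 2, ?_, ?_⟩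
    · have := one_lt_one_div hρ hρ1
      linarith
    · have : ρ * (1 / ρ) = 1 := by field_simp
      nlinarith
  have hdiff := differentiableOn_tsum_mul_pow hρ.le (by linarith : 0 ≤ R₁) hρR hd
  -- The zeros in a compact disc of radius R₂ > 1 form a compact set; one of least modulus lies
  -- outside the closed unit disc, so any R between 1 and that modulus works.
  obtain ⟨R, hR, hRR, hneR⟩ : ∃ R : ℝ, 1 < R ∧ R < R₁ ∧ ∀ z : ℂ, ‖z‖ ≤ R → D z ≠ 0 := by
    obtain ⟨R₂, h12, h21⟩ := exists_between hR₁
    have hcont : ContinuousOn D (Metric.closedBall 0 R₂) :=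
      hdiff.continuousOn.mono (Metric.closedBall_subset_ball h21)
    have hcl : IsCompact (Metric.closedBall (0 : ℂ) R₂ ∩ D ⁻¹' {0}) :=
      (isCompact_closedBall _ _).of_isClosed_subset
        (hcont.preimage_isClosed_of_isClosed Metric.isClosed_closedBall isClosed_singleton)
        inter_subset_left
    rcases (Metric.closedBall (0 : ℂ) R₂ ∩ D ⁻¹' {0}).eq_empty_or_nonempty with he | hn
    · refine ⟨R₂, h12, h21, fun z hz h0 => ?_⟩
      have : z ∈ Metric.closedBall (0 : ℂ) R₂ ∩ D ⁻¹' {0} := ⟨by simpa using hz, h0⟩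
      simp [he] at this
    · obtain ⟨z₀, hz₀, hmin⟩ := hcl.exists_isMinOn hn continuous_norm.continuousOn
      have h1 : 1 < ‖z₀‖ := by
        by_contra! h
        exact hne z₀ h hz₀.2
      obtain ⟨R, hR1, hR2⟩ := exists_between h1
      have h3 : ‖z₀‖ ≤ R₂ := by simpa using hz₀.1
      refine ⟨R, hR1, by linarith, fun z hz h0 => ?_⟩
      have : ‖z₀‖ ≤ ‖z‖ := hmin ⟨by simpa using (by linarith : ‖z‖ ≤ R₂), h0⟩
      linarith
  have hinv : DifferentiableOn ℂ (fun z => (D z)⁻¹) (Metric.closedBall 0 R) :=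
    (hdiff.mono (Metric.closedBall_subset_ball hRR)).inv fun z hz => hneR z (by simpa using hz)
  lift R to NNReal using by linarith
  have hps := hinv.hasFPowerSeriesOnBall (by exact_mod_cast one_pos.trans hR)
  -- Boundedness of s makes its power series converge on the open unit disc, where the convolution
  -- identity says that it is the reciprocal of D. By uniqueness, the Cauchy estimates on the larger
  -- disc apply to s.
  have hps2 : HasFPowerSeriesAt (fun z => (D z)⁻¹)
      (FormalMultilinearSeries.ofScalars ℂ (fun n => (s n : ℂ))) 0 := by
    rw [hasFPowerSeriesAt_iff]
    filter_upwards [Metric.ball_mem_nhds (0 : ℂ) one_pos] with z hz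
    have hz1 : ‖z‖ < 1 := by simpa using hz
    have hs1 : Summable fun n => ‖(s n : ℂ) * z ^ n‖ := by
      refine Summable.of_nonneg_of_le (fun n => norm_nonneg _) (fun n => ?_)
        ((summable_geometric_of_lt_one (norm_nonneg z) hz1).mul_left B)
      rw [norm_mul, norm_pow, Complex.norm_real, Real.norm_eq_abs]
      exact mul_le_mul_of_nonneg_right (hsB n) (by positivity)
    have hd1 : Summable fun n => ‖(d n : ℂ) * z ^ n‖ := by
      refine Summable.of_nonneg_of_le (fun n => norm_nonneg _) (fun n => ?_)
        ((summable_geometric_of_lt_one (mul_nonneg hρ.le (norm_nonneg z))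
          (by nlinarith [norm_nonneg z])).mul_left C)
      rw [norm_mul, norm_pow, Complex.norm_real, Real.norm_eq_abs, mul_pow, ← mul_assoc]
      exact mul_le_mul_of_nonneg_right (hd n) (by positivity)
    have hprod := tsum_mul_tsum_eq_tsum_sum_range_of_summable_norm hd1 hs1
    have hone : ∀ n, ∑ k ∈ Finset.range (n + 1), (d k : ℂ) * z ^ k * ((s (n - k) : ℂ) * z ^ (n - k))
        = if n = 0 then 1 else 0 := by
      intro n
      have : ∀ k ∈ Finset.range (n + 1), (d k : ℂ) * z ^ k * ((s (n - k) : ℂ) * z ^ (n - k))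
          = ((d k * s (n - k) : ℝ) : ℂ) * z ^ n := by
        intro k hk
        have hkn : k + (n - k) = n := by have := Finset.mem_range.1 hk; omega
        calc _ = (d k : ℂ) * s (n - k) * z ^ (k + (n - k)) := by rw [pow_add]; ring
          _ = _ := by rw [hkn]; push_cast; ring
      rw [Finset.sum_congr rfl this, ← Finset.sum_mul, ← Complex.ofReal_sum, hds]
      split_ifs with h <;> simp [h]
    simp_rw [hone] at hprod
    rw [tsum_ite_eq] at hprod
    have hval : (∑' n, (s n : ℂ) * z ^ n) = (D z)⁻¹ := eq_inv_of_mul_eq_one_right hprod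
    simp only [FormalMultilinearSeries.coeff_ofScalars, zero_add, smul_eq_mul]
    rw [← hval]
    simpa only [mul_comm] using hs1.of_norm.hasSum
  have heq := hps.hasFPowerSeriesAt.eq_formalMultilinearSeries hps2
  have hrad : ((1 : NNReal) : ENNReal) < R := by exact_mod_cast hR
  obtain ⟨r, hr1, hr2⟩ := ENNReal.lt_iff_exists_nnreal_btwn.1 hrad
  obtain ⟨K, hK, hb⟩ := FormalMultilinearSeries.norm_mul_pow_le_of_lt_radius _
    (hr2.trans_le hps.r_le)
  rw [heq] at hb
  have hr1' : (1 : ℝ) < r := by exact_mod_cast hr1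
  refine ⟨K, (r : ℝ)⁻¹, by positivity, inv_lt_one_of_one_lt₀ hr1', fun n => ?_⟩
  have := hb n
  rw [FormalMultilinearSeries.ofScalars_norm, Complex.norm_real, Real.norm_eq_abs] at this
  rw [inv_pow, ← div_eq_mul_inv, le_div_iff₀ (by positivity)]
  exact this

/-- The renewal theorem with exponential rate, for exponentially decaying interarrival
probabilities with `b 0 > 0`. -/
theorem renewal_exponential {b u : ℕ → ℝ} {C ρ : ℝ} (hρ : 0 < ρ) (hρ1 : ρ < 1)
    (hb : ∀ k, 0 ≤ b k) (hb0 : 0 < b 0) (hs : HasSum b 1) (hbC : ∀ k, b k ≤ C * ρ ^ k)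
    (hu0 : u 0 = 1) (hu : ∀ n, u (n + 1) = ∑ k ∈ Finset.range (n + 1), b k * u (n - k)) :
    (∃ K γ : ℝ, 0 < γ ∧ γ < 1 ∧ ∀ n, |u (n + 1) - u n| ≤ K * γ ^ n) ∧
      ∃ c : ℝ, 0 < c ∧ ∀ n, c ≤ u n := by
  have hsb := hs.summable
  -- An interarrival time equals k + 1 with probability b_k, so d below is the sequence of tails
  -- ℙ(time > k), and d * u = 1.
  have hC : 0 ≤ C := by simpa using (hb 0).trans (hbC 0)
  have hshift : ∀ k, Summable fun j => b (j + k) := fun k => (summable_nat_add_iff k).2 hsb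
  set d : ℕ → ℝ := fun k => ∑' j, b (j + k) with hd
  have hd0 : d 0 = 1 := by simpa [hd] using hs.tsum_eq
  have hdsucc : ∀ k, d k = b k + d (k + 1) := fun k => by
    simp only [hd]
    rw [(hshift k).tsum_eq_zero_add, zero_add]
    congr 2; ext j; congr 1; ring
  have hdnn : ∀ k, 0 ≤ d k := fun k => tsum_nonneg fun j => hb _
  have hgeo := summable_geometric_of_lt_one hρ.le hρ1
  have hdle : ∀ k, d k ≤ C / (1 - ρ) * ρ ^ k := fun k => by
    calc d k ≤ ∑' j, C * ρ ^ k * ρ ^ j := by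
          refine Summable.tsum_le_tsum (fun j => ?_) (hshift k) (hgeo.mul_left _)
          rw [mul_assoc, ← pow_add, add_comm k j]; exact hbC _
      _ = C / (1 - ρ) * ρ ^ k := by
          rw [tsum_mul_left, tsum_geometric_of_lt_one hρ.le hρ1]; ring
  have hunn : ∀ n, 0 ≤ u n := by
    intro n
    induction n using Nat.strong_induction_on with
    | _ n ih =>
      rcases n with _ | n
      · simp [hu0]
      · rw [hu]
        exact Finset.sum_nonneg fun k hk => mul_nonneg (hb k) (ih _ (by omega))
  have hu1 : ∀ n, u n ≤ 1 := by
    intro n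
    induction n using Nat.strong_induction_on with
    | _ n ih =>
      rcases n with _ | n
      · simp [hu0]
      · rw [hu]
        calc _ ≤ ∑ k ∈ Finset.range (n + 1), b k := Finset.sum_le_sum fun k hk =>
              mul_le_of_le_one_right (hb k) (ih _ (by omega))
          _ ≤ 1 := sum_le_hasSum _ (fun k _ => hb k) hs
  have hren : ∀ n, ∑ k ∈ Finset.range (n + 1), d k * u (n - k) = 1 := by
    intro n
    induction n with
    | zero => simp [hd0, hu0]
    | succ n ih =>
      rw [Finset.sum_range_succ', hd0, Nat.sub_zero, hu n, one_mul, ← Finset.sum_add_distrib, ← ih]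
      refine Finset.sum_congr rfl fun k _ => ?_
      rw [hdsucc k, Nat.add_sub_add_right]; ring
  -- Differencing d * u = 1 gives d * s = δ_0, so the generating function of the increments is 1/D.
  set s : ℕ → ℝ := fun n => if n = 0 then 1 else u n - u (n - 1) with hsdef
  have hconv : ∀ n, ∑ k ∈ Finset.range (n + 1), d k * s (n - k) = if n = 0 then 1 else 0 := by
    intro n
    rcases n with _ | n
    · simp [hd0, hsdef]
    · have h1 := hren (n + 1)
      rw [Finset.sum_range_succ] at h1 ⊢
      have h2 : ∀ k ∈ Finset.range (n + 1), d k * s (n + 1 - k)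
          = d k * u (n + 1 - k) - d k * u (n - k) := by
        intro k hk
        have : k < n + 1 := Finset.mem_range.1 hk
        have h3 : n + 1 - k ≠ 0 := by omega
        have h4 : n + 1 - k - 1 = n - k := by omega
        simp only [hsdef, h3, if_false, h4]; ring
      rw [Finset.sum_congr rfl h2, Finset.sum_sub_distrib, hren n]
      simp only [Nat.sub_self, hu0, hsdef, if_true] at h1 ⊢
      simp only [Nat.add_eq_zero_iff, one_ne_zero, and_false, if_false]
      linarith
  have hdsum : Summable d :=
    Summable.of_nonneg_of_le hdnn hdle (hgeo.mul_left _)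
  -- (1 - z) D(z) = 1 - Σ b_k z^{k+1}, so a zero of D in the closed disc can only be z = 1, but D(1)
  -- ≥ d_0 = 1.
  have hne : ∀ z : ℂ, ‖z‖ ≤ 1 → ∑' k, (d k : ℂ) * z ^ k ≠ 0 := by
    intro z hz h0
    have hsz : ∀ (f : ℕ → ℝ) (m : ℕ), Summable f → (∀ k, 0 ≤ f k) →
        Summable fun k => (f k : ℂ) * z ^ (k + m) := by
      intro f m hf hf0
      refine Summable.of_norm_bounded hf fun k => ?_
      rw [norm_mul, norm_pow, Complex.norm_real, Real.norm_eq_abs, abs_of_nonneg (hf0 k)]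
      exact mul_le_of_le_one_right (hf0 k) (pow_le_one₀ (norm_nonneg _) hz)
    have h1 := (hsz d 0 hdsum hdnn).hasSum
    simp only [add_zero, h0] at h1
    have h2 := (h1.mul_left z)
    have h3 := (hasSum_nat_add_iff' 1).2 h1
    simp only [Finset.range_one, Finset.sum_singleton, hd0, pow_zero, mul_one, zero_sub,
      Complex.ofReal_one] at h3
    have h4 : HasSum (fun k => (b k : ℂ) * z ^ (k + 1)) 1 := by
      have := h2.sub h3
      rw [mul_zero, sub_neg_eq_add, zero_add] at this
      refine (funext fun k => ?_ : (fun k => (b k : ℂ) * z ^ (k + 1)) = _) ▸ this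
      rw [hdsucc k]; push_cast; ring
    have hz1 := eq_one_of_tsum_mul_pow_eq_one hb hb0 hs hz h4
    rw [hz1] at h0
    simp only [one_pow, mul_one] at h0
    rw [← Complex.ofReal_tsum] at h0
    have h5 : ∑' k, d k = 0 := by exact_mod_cast h0
    have h6 := hdsum.le_tsum 0 fun k _ => hdnn k
    rw [hd0, h5] at h6
    linarith
  constructor
  · obtain ⟨K, γ, hγ, hγ1, hK⟩ := exists_abs_le_of_convolution_eq_single hρ hρ1
      (fun k => by rw [abs_of_nonneg (hdnn k)]; exact hdle k) (B := 1) (fun n => by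
        rcases n with _ | n
        · simp [hsdef]
        · simp only [hsdef, Nat.add_eq_zero_iff, one_ne_zero, and_false, if_false,
            Nat.add_sub_cancel]
          rw [abs_le]; constructor <;> linarith [hunn n, hu1 n, hunn (n + 1), hu1 (n + 1)])
      hne hconv
    refine ⟨K * γ, γ, hγ, hγ1, fun n => ?_⟩
    have := hK (n + 1)
    simp only [hsdef, Nat.add_eq_zero_iff, one_ne_zero, and_false, if_false,
      Nat.add_sub_cancel] at this
    rwa [pow_succ', ← mul_assoc] at this
  · have hstep : ∀ n, b 0 * u n ≤ u (n + 1) := fun n => by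
      rw [hu]
      have := Finset.single_le_sum (f := fun k => b k * u (n - k))
        (fun k _ => mul_nonneg (hb k) (hunn _)) (Finset.mem_range.2 n.succ_pos)
      simpa using this
    have hstep' : ∀ n k, b 0 ^ k * u n ≤ u (n + k) := fun n k => by
      induction k with
      | zero => simp
      | succ k ih =>
        calc b 0 ^ (k + 1) * u n = b 0 * (b 0 ^ k * u n) := by ring
          _ ≤ b 0 * u (n + k) := mul_le_mul_of_nonneg_left ih hb0.le
          _ ≤ _ := hstep _
    have hb01 : b 0 ≤ 1 := le_hasSum hs 0 fun k _ => hb k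
    -- In d * u = 1 the terms with k ≥ N contribute at most 1/2, and those with k < N satisfy b_0^N
    -- u_{n-k} ≤ u_n. This yields the bound b_0^N / (2A).
    obtain ⟨N, hN⟩ : ∃ N, ∑' k, d (k + N) < 1 / 2 := by
      have := tendsto_sum_nat_add d
      exact (this.eventually (gt_mem_nhds (by norm_num))).exists
    set A : ℝ := ∑' k, d k with hA
    have hA1 : 1 ≤ A := by
      rw [← hd0]; exact hdsum.le_tsum 0 fun k _ => hdnn k
    refine ⟨b 0 ^ N / (2 * A), by positivity, fun n => ?_⟩
    have key : ∀ k ∈ Finset.range (n + 1), b 0 ^ N * (d k * u (n - k)) ≤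
        d k * u n + b 0 ^ N * (if N ≤ k then d k else 0) := by
      intro k hk
      have hkn : k ≤ n := by have := Finset.mem_range.1 hk; omega
      split_ifs with h
      · have h1 : d k * u (n - k) ≤ d k := mul_le_of_le_one_right (hdnn k) (hu1 _)
        have h2 : 0 ≤ d k * u n := mul_nonneg (hdnn k) (hunn n)
        have h3 : 0 ≤ b 0 ^ N := by positivity
        nlinarith
      · have h1 := hstep' (n - k) k
        rw [Nat.sub_add_cancel hkn] at h1
        have h2 : b 0 ^ N ≤ b 0 ^ k := pow_le_pow_of_le_one hb0.le hb01 (by omega)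
        have h3 : b 0 ^ N * u (n - k) ≤ u n :=
          (mul_le_mul_of_nonneg_right h2 (hunn _)).trans h1
        have := mul_le_mul_of_nonneg_left h3 (hdnn k)
        linarith
    have hsum := Finset.sum_le_sum key
    rw [← Finset.mul_sum, hren n, Finset.sum_add_distrib, ← Finset.sum_mul, ← Finset.mul_sum] at hsum
    have htail : ∑ k ∈ Finset.range (n + 1), (if N ≤ k then d k else 0) ≤ 1 / 2 := by
      have h1 : Summable fun k => if N ≤ k then d k else 0 :=
        Summable.of_nonneg_of_le (fun k => by split_ifs <;> simp [hdnn])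
          (fun k => by split_ifs <;> simp [hdnn]) hdsum
      have h2 := h1.sum_le_tsum (Finset.range (n + 1)) (fun k _ => by split_ifs <;> simp [hdnn])
      have h3 := h1.sum_add_tsum_nat_add N
      have h4 : ∑ k ∈ Finset.range N, (if N ≤ k then d k else 0) = 0 :=
        Finset.sum_eq_zero fun k hk => if_neg (by have := Finset.mem_range.1 hk; omega)
      have h5 : ∀ k, (if N ≤ k + N then d (k + N) else 0) = d (k + N) := fun k =>
        if_pos (Nat.le_add_left _ _)
      simp_rw [h4, h5] at h3
      linarith
    have hhead : ∑ k ∈ Finset.range (n + 1), d k ≤ A := hdsum.sum_le_tsum _ fun k _ => hdnn k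
    rw [div_le_iff₀ (by positivity)]
    have h1 := mul_le_mul_of_nonneg_right hhead (hunn n)
    have h2 := mul_le_mul_of_nonneg_left htail (by positivity : 0 ≤ b 0 ^ N)
    nlinarith

/-! ### Action of the killed kernel on half-line indicators -/

section

variable {a p : ℝ}

/-- The transition operator of the chain killed when it becomes negative. -/
def killed (a p : ℝ) (f : ℝ → ℝ) (x : ℝ) : ℝ :=
  p * f (a * x + 1) + (1 - p) * if 1 ≤ a * x then f (a * x - 1) else 0

/-- The survival function `x ↦ ℙ_x(τ > n)`. -/
def survival (a p : ℝ) (n : ℕ) (x : ℝ) : ℝ := (killed a p)^[n] (fun _ => 1) x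

open scoped Classical in
/-- The weight of one step of `T` at `y`. -/
def weight (a p y : ℝ) : ℝ := if y ∈ hole a then 0 else if y < 1 then 1 - p else p

/-- The product of the weights along the first `k` steps of the orbit of `y` under `T`. -/
def pathWeight (a p : ℝ) : ℕ → ℝ → ℝ
  | 0, _ => 1
  | k + 1, y => weight a p y * pathWeight a p k (T a y)

/-- The coefficients of the expansion of the killed kernel applied to `1_{(y, ∞)}`. -/
def coef (a p y : ℝ) (k : ℕ) : ℝ := delta a y k * p * pathWeight a p k y

theorem mem_stateSpace_iff (ha1 : a < 1) {x : ℝ} :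
    x ∈ stateSpace a ↔ 0 ≤ x ∧ x * (1 - a) ≤ 1 := by
  rw [stateSpace, mem_Icc, le_div_iff₀ (by linarith)]

theorem mem_hole_iff (ha1 : a < 1) {x : ℝ} :
    x ∈ hole a ↔ 2 * a - 1 < x * (1 - a) ∧ x < 1 := by
  rw [hole, mem_Ioo, div_lt_iff₀ (by linarith)]

theorem up_mem (ha0 : 0 ≤ a) (ha1 : a < 1) {x : ℝ} (hx : x ∈ stateSpace a) :
    a * x + 1 ∈ stateSpace a := by
  rw [mem_stateSpace_iff ha1] at *
  constructor
  · nlinarith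
  · nlinarith

theorem down_mem (ha0 : 0 ≤ a) (ha1 : a < 1) {x : ℝ} (hx : x ∈ stateSpace a) (h : 1 ≤ a * x) :
    a * x - 1 ∈ stateSpace a := by
  rw [mem_stateSpace_iff ha1] at *
  constructor
  · linarith
  · nlinarith

theorem T_mem (ha : 0 < a) (ha1 : a < 1) {y : ℝ} (hy : y ∈ stateSpace a) (hh : y ∉ hole a) :
    T a y ∈ stateSpace a := by
  rw [mem_hole_iff ha1, not_and, not_lt] at hh
  rw [mem_stateSpace_iff ha1] at *
  unfold T
  split_ifs with h
  · have h2 : y * (1 - a) ≤ 2 * a - 1 := by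
      by_contra! h2
      linarith [hh h2]
    refine ⟨div_nonneg (by linarith) ha.le, ?_⟩
    rw [div_mul_eq_mul_div, div_le_one ha]
    nlinarith
  · refine ⟨div_nonneg (by linarith) ha.le, ?_⟩
    rw [div_mul_eq_mul_div, div_le_one ha]
    nlinarith

theorem delta_succ (y : ℝ) (k : ℕ) : delta a y (k + 1) = delta a (T a y) k := rfl

theorem delta_nonneg (y : ℝ) (k : ℕ) : (0 : ℝ) ≤ delta a y k := Nat.cast_nonneg _

theorem coef_zero (y : ℝ) : coef a p y 0 = delta a y 0 * p := by simp [coef, pathWeight]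

theorem coef_succ (y : ℝ) (k : ℕ) :
    coef a p y (k + 1) = weight a p y * coef a p (T a y) k := by
  simp only [coef, pathWeight, delta_succ]; ring

theorem weight_nonneg (hp : 0 ≤ p) (hp' : p ≤ 1) (y : ℝ) : 0 ≤ weight a p y := by
  unfold weight; split_ifs <;> linarith

theorem pathWeight_nonneg (hp : 0 ≤ p) (hp' : p ≤ 1) (k : ℕ) (y : ℝ) :
    0 ≤ pathWeight a p k y := by
  induction k generalizing y with
  | zero => simp [pathWeight]
  | succ k ih => exact mul_nonneg (weight_nonneg hp hp' y) (ih _)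

theorem coef_nonneg (hp : 0 ≤ p) (hp' : p ≤ 1) (y : ℝ) (k : ℕ) : 0 ≤ coef a p y k :=
  mul_nonneg (mul_nonneg (delta_nonneg _ _) hp) (pathWeight_nonneg hp hp' _ _)

theorem pathWeight_add (j k : ℕ) (y : ℝ) :
    pathWeight a p (j + k) y = pathWeight a p j y * pathWeight a p k ((T a)^[j] y) := by
  induction j generalizing y with
  | zero => simp [pathWeight]
  | succ j ih => rw [Nat.add_right_comm]; simp [pathWeight, ih, mul_assoc]

theorem pathWeight_succ (k : ℕ) (y : ℝ) :
    pathWeight a p (k + 1) y = pathWeight a p k y * weight a p ((T a)^[k] y) := by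
  rw [pathWeight_add]; simp [pathWeight]

/-- An orbit can leave the state space only by passing through the hole, where the weight vanishes;
later points, at which `T` has no meaning, therefore never count. -/
theorem pathWeight_eq_zero_or_mem (ha : 0 < a) (ha1 : a < 1) {y : ℝ} (hy : y ∈ stateSpace a)
    (k : ℕ) : pathWeight a p k y = 0 ∨ (T a)^[k] y ∈ stateSpace a := by
  induction k with
  | zero => exact Or.inr hy
  | succ k ih =>
    rcases ih with h | h
    · left; rw [pathWeight_succ, h, zero_mul]
    · by_cases hh : (T a)^[k] y ∈ hole a
      · left; rw [pathWeight_succ, weight, if_pos hh, mul_zero]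
      · right; rw [Function.iterate_succ_apply']; exact T_mem ha ha1 h hh

theorem le_kappa_iff (y : ℝ) (k : ℕ) :
    (k : ℕ∞) ≤ kappa a y ↔ ∀ j < k, (T a)^[j] y ∉ hole a := by
  simp only [kappa, le_iInf_iff, Nat.cast_le]
  exact forall_congr' fun j => ⟨fun h hj hh => absurd (h hh) (by omega),
    fun h hh => by by_contra! hj; exact h hj hh⟩

open scoped Classical in
-- The hole weight 0 encodes the cutoff: the product of the first k weights involves the points 0,
-- …, k - 1 only, so the term k = ϰ still survives.
theorem pathWeight_eq (hp : p ≠ 0) (y : ℝ) (k : ℕ) :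
    pathWeight a p k y =
      if (k : ℕ∞) ≤ kappa a y then p ^ k * ((1 - p) / p) ^ occ a y k else 0 := by
  induction k with
  | zero => simp [pathWeight, occ]
  | succ k ih =>
    have hiff : ((k + 1 : ℕ) : ℕ∞) ≤ kappa a y ↔
        (k : ℕ∞) ≤ kappa a y ∧ (T a)^[k] y ∉ hole a := by
      rw [le_kappa_iff, le_kappa_iff]
      exact Nat.forall_lt_succ_right
    have hocc : occ a y (k + 1) = occ a y k + delta a y k := Finset.sum_range_succ _ _
    rw [pathWeight_succ, ih, weight]
    by_cases h1 : (k : ℕ∞) ≤ kappa a y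
    · by_cases h2 : (T a)^[k] y ∈ hole a
      · rw [if_pos h2, mul_zero, if_neg (fun h => (hiff.1 h).2 h2)]
      · rw [if_pos h1, if_neg h2, if_pos (hiff.2 ⟨h1, h2⟩), hocc, delta]
        split_ifs with h3
        · rw [pow_succ p, pow_succ ((1 - p) / p)]; field_simp
        · rw [pow_succ p, add_zero]; ring
    · rw [if_neg h1, zero_mul, if_neg (fun h => h1 (hiff.1 h).1)]

theorem term_eq (hp : p ≠ 0) (l y : ℝ) (k : ℕ) :
    term a p l y k = coef a p y k * (1 / l) ^ (k + 1) := by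
  rw [term, coef, pathWeight_eq hp]
  split_ifs with h
  · rw [div_eq_mul_one_div p l, mul_pow, pow_succ p]; ring
  · simp

theorem killed_congr (ha0 : 0 ≤ a) (ha1 : a < 1) {f g : ℝ → ℝ} (h : EqOn f g (stateSpace a)) :
    EqOn (killed a p f) (killed a p g) (stateSpace a) := by
  intro x hx
  unfold killed
  rw [h (up_mem ha0 ha1 hx)]
  split_ifs with h1
  · rw [h (down_mem ha0 ha1 hx h1)]
  · rfl

theorem killed_iterate_congr (ha0 : 0 ≤ a) (ha1 : a < 1) (n : ℕ) {f g : ℝ → ℝ}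
    (h : EqOn f g (stateSpace a)) :
    EqOn ((killed a p)^[n] f) ((killed a p)^[n] g) (stateSpace a) := by
  induction n generalizing f g with
  | zero => exact h
  | succ n ih => exact ih (killed_congr ha0 ha1 h)

theorem killed_linear (A B : ℝ) (f g : ℝ → ℝ) :
    killed a p (fun x => A * f x + B * g x) = fun x => A * killed a p f x + B * killed a p g x := by
  ext x
  unfold killed
  split_ifs <;> ring

theorem killed_iterate_linear (n : ℕ) (A B : ℝ) (f g : ℝ → ℝ) :
    (killed a p)^[n] (fun x => A * f x + B * g x)
      = fun x => A * (killed a p)^[n] f x + B * (killed a p)^[n] g x := by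
  induction n generalizing f g with
  | zero => rfl
  | succ n ih => simp only [Function.iterate_succ_apply, killed_linear, ih]

theorem killed_mono (hp : 0 ≤ p) (hp' : p ≤ 1) {f g : ℝ → ℝ} (h : f ≤ g) :
    killed a p f ≤ killed a p g := by
  intro x
  unfold killed
  have h1 := mul_le_mul_of_nonneg_left (h (a * x + 1)) hp
  have h2 := mul_le_mul_of_nonneg_left (h (a * x - 1)) (sub_nonneg.2 hp')
  split_ifs <;> linarith

theorem killed_iterate_mono (hp : 0 ≤ p) (hp' : p ≤ 1) (n : ℕ) {f g : ℝ → ℝ} (h : f ≤ g) :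
    (killed a p)^[n] f ≤ (killed a p)^[n] g := by
  induction n generalizing f g with
  | zero => exact h
  | succ n ih => exact ih (killed_mono hp hp' h)

theorem killed_iterate_nonneg (hp : 0 ≤ p) (hp' : p ≤ 1) (n : ℕ) {f : ℝ → ℝ} (h : ∀ x, 0 ≤ f x)
    (x : ℝ) : 0 ≤ (killed a p)^[n] f x := by
  have h0 : (killed a p)^[n] (fun _ => 0) = fun _ => 0 := by
    simpa using killed_iterate_linear (a := a) (p := p) n 0 0 (fun _ => 0) (fun _ => 0)
  have := killed_iterate_mono (a := a) hp hp' n (f := fun _ => 0) h x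
  rwa [h0] at this

/-- Iterating a one-step expansion of the killed kernel along the orbits of `T`. -/
theorem killed_iterate_expansion (ha : 0 < a) (ha1 : a < 1) {Y : Set ℝ} {h : ℝ → ℝ → ℝ}
    (hY : ∀ y ∈ Y, y ∉ hole a → T a y ∈ Y)
    (hh : ∀ y ∈ Y, ∀ x ∈ stateSpace a,
      killed a p (h y) x = delta a y 0 * p + weight a p y * h (T a y) x)
    (n : ℕ) {y : ℝ} (hy : y ∈ Y) {x : ℝ} (hx : x ∈ stateSpace a) :
    (killed a p)^[n] (h y) x = ∑ k ∈ Finset.range n, coef a p y k * survival a p (n - 1 - k) x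
      + pathWeight a p n y * h ((T a)^[n] y) x := by
  induction n generalizing y with
  | zero => simp [pathWeight]
  | succ n ih =>
    have h1 : EqOn (killed a p (h y))
        (fun x => delta a y 0 * p * (fun _ => 1) x + weight a p y * h (T a y) x)
        (stateSpace a) := fun x hx => by simpa using hh y hy x hx
    rw [Function.iterate_succ_apply, killed_iterate_congr ha.le ha1 n h1 hx,
      killed_iterate_linear, Finset.sum_range_succ']
    have h2 : weight a p y * (killed a p)^[n] (h (T a y)) x
        = ∑ k ∈ Finset.range n, coef a p y (k + 1) * survival a p (n + 1 - 1 - (k + 1)) x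
          + pathWeight a p (n + 1) y * h ((T a)^[n + 1] y) x := by
      -- On the hole `T a y` may lie outside `Y`, so the induction hypothesis is unavailable, but
      -- the factor `weight a p y` is 0.
      by_cases hm : y ∈ hole a
      · have hw : weight a p y = 0 := if_pos hm
        simp [coef_succ, pathWeight, hw]
      · rw [ih (hY y hy hm), mul_add, Finset.mul_sum]
        congr 1
        · refine Finset.sum_congr rfl fun k _ => ?_
          rw [coef_succ, mul_assoc, show n + 1 - 1 - (k + 1) = n - 1 - k by omega]
        · rw [pathWeight, mul_assoc, Function.iterate_succ_apply]
    simp only at h2 ⊢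
    rw [h2, coef_zero]
    simp only [survival, Nat.add_sub_cancel, Nat.sub_zero]
    ring

/-- For y < 1 every up step lands above y, which gives the constant p; a down step lands above y iff
x > (y+1)/a, which is impossible when y is in the hole. For y ≥ 1 no down step passes y, since it
ends at most at (2a-1)/(1-a) ≤ 1; this is where a ≤ 2/3 enters. -/
theorem killed_indicator_Ioi (ha : 1 / 2 < a) (ha' : a ≤ 2 / 3) {y : ℝ} (hy : y ∈ stateSpace a)
    {x : ℝ} (hx : x ∈ stateSpace a) :
    killed a p ((Ioi y).indicator 1) x =
      delta a y 0 * p + weight a p y * (Ioi (T a y)).indicator 1 x := by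
  have ha1 : a < 1 := by linarith
  have ha0 : 0 < a := by linarith
  rw [mem_stateSpace_iff ha1] at hx hy
  have hax : 0 ≤ a * x := mul_nonneg ha0.le hx.1
  simp only [killed, delta, weight, T, indicator, mem_Ioi, Pi.one_apply, mem_hole_iff ha1,
    Function.iterate_zero, id]
  by_cases h1 : y < 1
  · have e1 : y < a * x + 1 := by linarith
    simp only [h1, if_true, e1, and_true]
    by_cases h2 : 2 * a - 1 < y * (1 - a)
    · have : ¬ (y < a * x - 1) := by intro h; nlinarith
      simp [h2, this]
    · rw [if_neg h2]
      have : (1 ≤ a * x ∧ y < a * x - 1) ↔ (y + 1) / a < x := by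
        rw [div_lt_iff₀ ha0]
        exact ⟨fun h => by linarith [h.2], fun h => ⟨by linarith, by linarith⟩⟩
      rw [← ite_and, if_congr this rfl rfl]
      simp
  · have : ¬ (y < a * x - 1) := by intro h; nlinarith
    have h3 : y < a * x + 1 ↔ (y - 1) / a < x := by
      rw [div_lt_iff₀ ha0]; constructor <;> intro h <;> linarith
    simp [h1, this, h3]

/-- The closed version fails only if a down step from 1/(1-a) lands exactly on y = 1, which requires
a = 2/3. Closed half-lines are needed because 1_{[0,∞)}, unlike 1_{(0,∞)}, is 1 on the whole state
space. -/
theorem killed_indicator_Ici (ha : 1 / 2 < a) (ha' : a ≤ 2 / 3) {y : ℝ} (hy : y ∈ stateSpace a)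
    (hy1 : a = 2 / 3 → y ≠ 1) {x : ℝ} (hx : x ∈ stateSpace a) :
    killed a p ((Ici y).indicator 1) x =
      delta a y 0 * p + weight a p y * (Ici (T a y)).indicator 1 x := by
  have ha1 : a < 1 := by linarith
  have ha0 : 0 < a := by linarith
  rw [mem_stateSpace_iff ha1] at hx hy
  have hax : 0 ≤ a * x := mul_nonneg ha0.le hx.1
  simp only [killed, delta, weight, T, indicator, mem_Ici, Pi.one_apply, mem_hole_iff ha1,
    Function.iterate_zero, id]
  by_cases h1 : y < 1
  · have e1 : y ≤ a * x + 1 := by linarith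
    simp only [h1, if_true, e1, and_true]
    by_cases h2 : 2 * a - 1 < y * (1 - a)
    · have : ¬ (y ≤ a * x - 1) := by intro h; nlinarith
      simp [h2, this]
    · rw [if_neg h2]
      have : (1 ≤ a * x ∧ y ≤ a * x - 1) ↔ (y + 1) / a ≤ x := by
        rw [div_le_iff₀ ha0]
        exact ⟨fun h => by linarith [h.2], fun h => ⟨by linarith, by linarith⟩⟩
      rw [← ite_and, if_congr this rfl rfl]
      simp
  · have : ¬ (y ≤ a * x - 1) := by
      intro h
      have h4 : y = 1 := by nlinarith
      have h5 : a = 2 / 3 := by nlinarith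
      exact hy1 h5 h4
    have h3 : y ≤ a * x + 1 ↔ (y - 1) / a ≤ x := by
      rw [div_le_iff₀ ha0]; constructor <;> intro h <;> linarith
    simp [h1, this, h3]

/-- For `a = 2/3` the orbit of `0` consists of odd multiples of powers of `1/2`. -/
theorem iterate_T_zero_eq (k : ℕ) :
    ∃ m : ℤ, Odd m ∧ (T (2 / 3))^[k + 1] 0 * 2 ^ (k + 1) = m := by
  induction k with
  | zero => exact ⟨3, by decide, by norm_num [T]⟩
  | succ k ih =>
    obtain ⟨m, hm, h⟩ := ih
    rw [Function.iterate_succ_apply']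
    set t := (T (2 / 3))^[k + 1] 0 with ht
    have he : Even ((2 : ℤ) ^ (k + 1)) := (by decide : Even (2 : ℤ)).pow_of_ne_zero (by omega)
    by_cases h1 : t < 1
    · refine ⟨3 * (m + 2 ^ (k + 1)), (by decide : Odd (3 : ℤ)).mul (hm.add_even he), ?_⟩
      rw [T, if_pos h1]; push_cast; rw [← h]; ring
    · refine ⟨3 * (m - 2 ^ (k + 1)), (by decide : Odd (3 : ℤ)).mul (hm.sub_even he), ?_⟩
      rw [T, if_neg h1]; push_cast; rw [← h]; ring

/-- If T^{k+1}(0) were 1, the odd integer of the previous lemma would be 2^{k+1}. -/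
theorem iterate_T_zero_ne_one (h : a = 2 / 3) (k : ℕ) : (T a)^[k] 0 ≠ 1 := by
  subst h
  rcases k with _ | k
  · simp
  · intro h1
    obtain ⟨m, hm, h⟩ := iterate_T_zero_eq k
    rw [h1, one_mul] at h
    have h2 : (2 : ℤ) ^ (k + 1) = m := by exact_mod_cast h
    rw [← h2] at hm
    exact (Int.not_odd_iff_even.2 ((by decide : Even (2 : ℤ)).pow_of_ne_zero (by omega))) hm

theorem zero_mem (ha1 : a < 1) : (0 : ℝ) ∈ stateSpace a := by
  rw [mem_stateSpace_iff ha1]; norm_num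

theorem killed_iterate_indicator_Ioi (ha : 1 / 2 < a) (ha' : a ≤ 2 / 3) (n : ℕ) {y : ℝ}
    (hy : y ∈ stateSpace a) {x : ℝ} (hx : x ∈ stateSpace a) :
    (killed a p)^[n] ((Ioi y).indicator 1) x =
      ∑ k ∈ Finset.range n, coef a p y k * survival a p (n - 1 - k) x
      + pathWeight a p n y * (Ioi ((T a)^[n] y)).indicator 1 x :=
  killed_iterate_expansion (Y := stateSpace a) (h := fun y => (Ioi y).indicator 1) (by linarith)
    (by linarith) (fun _ hy hh => T_mem (by linarith) (by linarith) hy hh)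
    (fun _ hy _ hx => killed_indicator_Ioi ha ha' hy hx) n hy hx

/-- The renewal equation for the survival probabilities. -/
theorem survival_eq (ha : 1 / 2 < a) (ha' : a ≤ 2 / 3) (n : ℕ) {x : ℝ} (hx : x ∈ stateSpace a) :
    survival a p n x =
      ∑ k ∈ Finset.range n, coef a p 0 k * survival a p (n - 1 - k) x
      + pathWeight a p n 0 * (Ici ((T a)^[n] 0)).indicator 1 x := by
  have ha1 : a < 1 := by linarith
  -- The expansion is restricted to the orbit of 0, which avoids the exceptional point y = 1 of the
  -- closed half-line identity.
  rw [← killed_iterate_expansion (Y := {y | y ∈ stateSpace a ∧ ∃ k, y = (T a)^[k] 0})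
    (h := fun y => (Ici y).indicator 1) (by linarith) ha1 ?_ ?_ n ⟨zero_mem ha1, 0, rfl⟩ hx]
  · refine killed_iterate_congr (by linarith) ha1 n (fun z hz => ?_) hx
    simp [((mem_stateSpace_iff ha1).1 hz).1]
  · rintro y ⟨hy, k, rfl⟩ hh
    exact ⟨T_mem (by linarith) ha1 hy hh, k + 1, (Function.iterate_succ_apply' _ _ _).symm⟩
  · rintro y ⟨hy, k, rfl⟩ x hx
    exact killed_indicator_Ici ha ha' hy (fun h => iterate_T_zero_ne_one h k) hx

end

/-! ### The critical parameter and uniform decay of the weights -/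

section

variable {a p : ℝ}

/-- Summing the hypothesis over n gives (Σ c)(Σ A) ≤ Σ A - A_0 < Σ A. Truncating c at N makes the
product legitimate before c is known to be summable. -/
theorem sum_range_le_one_of_convolution_le {c A : ℕ → ℝ} (hc : ∀ k, 0 ≤ c k) (hA : ∀ n, 0 ≤ A n)
    (hA0 : 0 < A 0) (hs : Summable A)
    (h : ∀ n, ∑ k ∈ Finset.range n, c k * A (n - 1 - k) ≤ A n) (N : ℕ) :
    ∑ k ∈ Finset.range N, c k ≤ 1 := by
  set c' : ℕ → ℝ := fun k => if k < N then c k else 0 with hc'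
  have hc'0 : ∀ k, 0 ≤ c' k := fun k => by simp only [hc']; split_ifs <;> simp [hc]
  have hle : ∀ k, c' k ≤ c k := fun k => by simp only [hc']; split_ifs <;> simp [hc]
  have hzero : ∀ k ∉ Finset.range N, c' k = 0 := fun k hk => by
    simp only [hc']; rw [if_neg (by simpa using hk)]
  have hsc : Summable c' := summable_of_ne_finset_zero hzero
  have hsum : ∑' k, c' k = ∑ k ∈ Finset.range N, c k := by
    rw [tsum_eq_sum hzero]
    exact Finset.sum_congr rfl fun k hk => if_pos (Finset.mem_range.1 hk)
  have hcn : Summable fun k => ‖c' k‖ := hsc.norm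
  have hAn : Summable fun k => ‖A k‖ := hs.norm
  have hprod := tsum_mul_tsum_eq_tsum_sum_range_of_summable_norm hcn hAn
  have hconv := (summable_norm_sum_mul_range_of_summable_norm hcn hAn).of_norm
  have h1 : ∑' n, ∑ k ∈ Finset.range (n + 1), c' k * A (n - k) ≤ ∑' n, A (n + 1) := by
    refine hconv.tsum_le_tsum (fun n => ?_) ((summable_nat_add_iff 1).2 hs)
    refine le_trans (Finset.sum_le_sum fun k _ => ?_) (h (n + 1))
    rw [Nat.add_sub_cancel]
    exact mul_le_mul_of_nonneg_right (hle k) (hA _)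
  have h2 := hs.tsum_eq_zero_add
  have h3 : 0 ≤ ∑' n, A (n + 1) := tsum_nonneg fun n => hA _
  rw [← hprod, hsum] at h1
  by_contra! h4
  nlinarith

/-- The partial sums satisfy Σ A ≤ F Σ A + Σ g, and F < 1 lets the first term be absorbed. -/
theorem summable_of_le_convolution_add {c A g : ℕ → ℝ} {F : ℝ} (hc : ∀ k, 0 ≤ c k)
    (hA : ∀ n, 0 ≤ A n) (hg : ∀ n, 0 ≤ g n) (hcs : HasSum c F) (hF : F < 1) (hgs : Summable g)
    (h : ∀ n, A n ≤ ∑ k ∈ Finset.range n, c k * A (n - 1 - k) + g n) : Summable A := by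
  have hpart : ∀ N, ∑ n ∈ Finset.range (N + 1), ∑ k ∈ Finset.range n, c k * A (n - 1 - k)
      ≤ F * ∑ n ∈ Finset.range (N + 1), A n := by
    intro N
    rw [Finset.sum_range_succ']
    simp only [Finset.range_zero, Finset.sum_empty, add_zero, Nat.add_sub_cancel]
    rw [Finset.sum_range_diag_flip N (fun k m => c k * A m)]
    calc _ ≤ ∑ k ∈ Finset.range N, c k * ∑ n ∈ Finset.range (N + 1), A n := by
          refine Finset.sum_le_sum fun k _ => ?_
          rw [← Finset.mul_sum]
          refine mul_le_mul_of_nonneg_left ?_ (hc k)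
          exact Finset.sum_le_sum_of_subset_of_nonneg
            (Finset.range_subset_range.2 (by omega)) fun n _ _ => hA n
      _ ≤ _ := by
          rw [← Finset.sum_mul]
          exact mul_le_mul_of_nonneg_right (sum_le_hasSum _ (fun k _ => hc k) hcs)
            (Finset.sum_nonneg fun n _ => hA n)
  refine summable_of_sum_range_le (c := (∑' n, g n) / (1 - F)) hA fun N => ?_
  refine le_trans (Finset.sum_le_sum_of_subset_of_nonneg
    (Finset.range_subset_range.2 N.le_succ) fun n _ _ => hA n) ?_
  rw [le_div_iff₀ (by linarith)]
  have h1 := Finset.sum_le_sum fun n (_ : n ∈ Finset.range (N + 1)) => h n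
  rw [Finset.sum_add_distrib] at h1
  have h2 := hgs.sum_le_tsum (Finset.range (N + 1)) fun n _ => hg n
  have h3 := hpart N
  simp only [Nat.succ_eq_add_one] at *
  nlinarith

theorem survival_nonneg (hp : 0 ≤ p) (hp' : p ≤ 1) (n : ℕ) (x : ℝ) : 0 ≤ survival a p n x :=
  killed_iterate_nonneg hp hp' n (fun _ => zero_le_one) x

theorem survival_le_one (hp : 0 ≤ p) (hp' : p ≤ 1) (n : ℕ) (x : ℝ) : survival a p n x ≤ 1 := by
  induction n generalizing x with
  | zero => exact le_rfl
  | succ n ih =>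
    have h1 : killed a p (fun _ => 1) ≤ fun _ => 1 := fun x => by
      unfold killed; split_ifs <;> linarith
    exact (killed_iterate_mono hp hp' n h1 x).trans (ih x)

theorem pow_le_survival (hp : 0 ≤ p) (hp' : p ≤ 1) (n : ℕ) (x : ℝ) :
    p ^ n ≤ survival a p n x := by
  induction n generalizing x with
  | zero => exact le_rfl
  | succ n ih =>
    rw [survival, Function.iterate_succ_apply', killed]
    have h1 := mul_le_mul_of_nonneg_left (ih (a * x + 1)) hp
    have h2 := survival_nonneg (a := a) hp hp' n (a * x - 1)
    have h3 : 0 ≤ (1 - p) * if 1 ≤ a * x then (killed a p)^[n] (fun _ => 1) (a * x - 1) else 0 :=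
      mul_nonneg (sub_nonneg.2 hp') (by split_ifs; exacts [h2, le_rfl])
    rw [pow_succ']
    simp only [survival] at h1
    linarith

theorem zero_notMem_hole (ha : 1 / 2 < a) (ha1 : a < 1) : (0 : ℝ) ∉ hole a := by
  rw [mem_hole_iff ha1]; intro h; linarith [h.1]

/-- The orbit of `0` under `T` returns below `1`. -/
theorem exists_iterate_T_lt_one (ha : 1 / 2 < a) (ha1 : a < 1) :
    ∃ k, 1 ≤ k ∧ (T a)^[k] 0 < 1 := by
  by_contra! h
  have ha0 : 0 < a := by linarith
  -- The point 1/(1-a) is the fixed point of the upper branch, which expands by 1/a. An orbit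
  -- starting at 1/a < 1/(1-a) and staying above 1 would move away from it geometrically, yet remain
  -- at bounded distance.
  have hkey : ∀ k, (1 / (1 - a) - (T a)^[k + 1] 0) * a ^ k = 1 / (1 - a) - 1 / a := by
    intro k
    induction k with
    | zero => simp [T]
    | succ k ih =>
      rw [Function.iterate_succ_apply', T, if_neg (not_lt.2 (h _ (by omega))), ← ih]
      have : 1 - a ≠ 0 := by linarith
      field_simp
      ring
  have hM : 0 < 1 / (1 - a) - 1 / a := by
    rw [sub_pos]; exact one_div_lt_one_div_of_lt (by linarith) (by linarith)
  have hM1 : 1 < 1 / (1 - a) := by rw [lt_div_iff₀ (by linarith)]; linarith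
  obtain ⟨k, hk⟩ := exists_pow_lt_of_lt_one
    (div_pos hM (by linarith : 0 < 1 / (1 - a))) ha1
  rw [lt_div_iff₀ (by linarith)] at hk
  have h1 := hkey k
  have h2 := h (k + 1) (by omega)
  have h3 : 0 < a ^ k := by positivity
  nlinarith

/-- Before its first return below 1 the orbit cannot meet the hole, so all weights up to that return
are positive. -/
theorem exists_coef_zero_pos (ha : 1 / 2 < a) (ha1 : a < 1) (hp : 0 < p) (hp' : p < 1) :
    ∃ k, 1 ≤ k ∧ 0 < coef a p 0 k := by
  classical
  have hex := exists_iterate_T_lt_one ha ha1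
  obtain ⟨hk1, hk⟩ := Nat.find_spec hex
  have hmin := fun j => Nat.find_min hex (m := j)
  set k := Nat.find hex
  have hpos : ∀ j < k, 0 < pathWeight a p (j + 1) 0 := by
    intro j hj
    induction j with
    | zero => simp [pathWeight, weight, zero_notMem_hole ha ha1, hp']
    | succ j ih =>
      rw [pathWeight_succ]
      refine mul_pos (ih (by omega)) ?_
      have h1 : ¬ (T a)^[j + 1] 0 < 1 := fun h => hmin (j + 1) hj ⟨by omega, h⟩
      rw [weight, if_neg (fun h => h1 h.2), if_neg h1]
      exact hp
  refine ⟨k, hk1, ?_⟩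
  have h2 := hpos (k - 1) (by omega)
  rw [Nat.sub_add_cancel hk1] at h2
  rw [coef, delta, if_pos hk]
  simp only [Nat.cast_one, one_mul]
  exact mul_pos hp h2

theorem top_mem (ha1 : a < 1) : 1 / (1 - a) ∈ stateSpace a :=
  ⟨one_div_nonneg.2 (by linarith), le_rfl⟩

/-- Dropping the remainder in the expansion and using Q^n 1_{(y,∞)} ≤ S_n leaves a convolution
inequality for S_n(1/(1-a)) z^n, the same for all y. -/
theorem sum_coef_le_one (ha : 1 / 2 < a) (ha' : a ≤ 2 / 3) (hp : 0 < p) (hp' : p < 1)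
    {z : ℝ} (hz : 0 ≤ z) (hs : Summable fun n => survival a p n (1 / (1 - a)) * z ^ n)
    {y : ℝ} (hy : y ∈ stateSpace a) (N : ℕ) :
    ∑ k ∈ Finset.range N, coef a p y k * z ^ (k + 1) ≤ 1 := by
  refine sum_range_le_one_of_convolution_le
    (A := fun n => survival a p n (1 / (1 - a)) * z ^ n)
    (fun k => mul_nonneg (coef_nonneg hp.le hp'.le _ _) (by positivity))
    (fun n => mul_nonneg (survival_nonneg hp.le hp'.le _ _) (by positivity))
    (by simp [survival]) hs (fun n => ?_) N
  have hx := top_mem (a := a) (by linarith)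
  have h1 := killed_iterate_indicator_Ioi (p := p) ha ha' n hy hx
  have h2 : (killed a p)^[n] ((Ioi y).indicator 1) (1 / (1 - a)) ≤ survival a p n (1 / (1 - a)) :=
    killed_iterate_mono hp.le hp'.le n
      (indicator_le_self' fun _ _ => zero_le_one) _
  have h3 : 0 ≤ pathWeight a p n y * (Ioi ((T a)^[n] y)).indicator 1 (1 / (1 - a)) :=
    mul_nonneg (pathWeight_nonneg hp.le hp'.le _ _) (indicator_nonneg (fun _ _ => zero_le_one) _)
  have h4 : ∑ k ∈ Finset.range n, coef a p y k * survival a p (n - 1 - k) (1 / (1 - a))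
      ≤ survival a p n (1 / (1 - a)) := by linarith
  refine le_trans (le_of_eq ?_) (mul_le_mul_of_nonneg_right h4 (by positivity : 0 ≤ z ^ n))
  rw [Finset.sum_mul]
  refine Finset.sum_congr rfl fun k hk => ?_
  have hkn : (k + 1) + (n - 1 - k) = n := by have := Finset.mem_range.1 hk; omega
  calc _ = coef a p y k * survival a p (n - 1 - k) (1 / (1 - a)) * z ^ (k + 1 + (n - 1 - k)) := by
        rw [pow_add]; ring
    _ = _ := by rw [hkn]

theorem weight_le (hp : 0 ≤ p) (hp' : p ≤ 1) (y : ℝ) (k : ℕ) :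
    weight a p ((T a)^[k] y) ≤ p + (1 - p) * delta a y k := by
  unfold weight delta
  split_ifs <;> simp <;> linarith

/-- By `weight_le`, W_{k+1} z^{k+1} ≤ pz · W_k z^k + (q/p) c_k z^{k+1}; after summation the first
term is absorbed because pz < 1. -/
theorem sum_pathWeight_le (hp : 0 < p) (hp' : p < 1) {z B : ℝ} (hz : 0 ≤ z) (hpz : p * z < 1)
    {y : ℝ} (hB : ∀ N, ∑ k ∈ Finset.range N, coef a p y k * z ^ (k + 1) ≤ B) (N : ℕ) :
    ∑ k ∈ Finset.range N, pathWeight a p k y * z ^ k ≤ (1 + (1 - p) / p * B) / (1 - p * z) := by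
  have hnn : ∀ k, 0 ≤ pathWeight a p k y * z ^ k := fun k =>
    mul_nonneg (pathWeight_nonneg hp.le hp'.le _ _) (by positivity)
  have hstep : ∀ k, pathWeight a p (k + 1) y * z ^ (k + 1)
      ≤ p * z * (pathWeight a p k y * z ^ k) + (1 - p) / p * (coef a p y k * z ^ (k + 1)) := by
    intro k
    have h1 := mul_le_mul_of_nonneg_left (weight_le (a := a) hp.le hp'.le y k)
      (mul_nonneg (hnn k) hz)
    rw [pathWeight_succ, coef]
    calc _ = pathWeight a p k y * z ^ k * z * weight a p ((T a)^[k] y) := by ring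
      _ ≤ _ := h1
      _ = _ := by field_simp; ring
  rw [le_div_iff₀ (by linarith)]
  have h1 := Finset.sum_le_sum fun k (_ : k ∈ Finset.range N) => hstep k
  rw [Finset.sum_add_distrib, ← Finset.mul_sum, ← Finset.mul_sum] at h1
  have h2 := Finset.sum_range_succ' (fun k => pathWeight a p k y * z ^ k) N
  have h3 := Finset.sum_range_succ (fun k => pathWeight a p k y * z ^ k) N
  have h4 := mul_le_mul_of_nonneg_left (hB N) (div_nonneg (sub_nonneg.2 hp'.le) hp.le)
  simp only [pathWeight, pow_zero, mul_one] at h2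
  have h5 := hnn N
  simp only [pathWeight] at h1
  linarith

/-- Uniform summability of the multiplicative cocycle `pathWeight` implies uniform exponential
decay. -/
theorem pathWeight_le_geometric (ha : 0 < a) (ha1 : a < 1) (hp : 0 < p) (hp' : p < 1) {z A : ℝ}
    (hz : 0 ≤ z) (hA : 1 < A)
    (hB : ∀ y ∈ stateSpace a, ∀ N, ∑ k ∈ Finset.range N, pathWeight a p k y * z ^ k ≤ A)
    {y : ℝ} (hy : y ∈ stateSpace a) (n : ℕ) :
    pathWeight a p n y * z ^ n ≤ A * (1 - 1 / A) ^ n := by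
  have hnn : ∀ y k, 0 ≤ pathWeight a p k y * z ^ k := fun y k =>
    mul_nonneg (pathWeight_nonneg hp.le hp'.le _ _) (by positivity)
  have hs : ∀ y ∈ stateSpace a, Summable fun k => pathWeight a p k y * z ^ k := fun y hy =>
    summable_of_sum_range_le (hnn y) (hB y hy)
  set S : ℕ → ℝ := fun n => ∑' k, pathWeight a p (n + k) y * z ^ (n + k) with hS
  have hs' : ∀ n, Summable fun k => pathWeight a p (n + k) y * z ^ (n + k) := fun n => by
    simpa only [add_comm n] using (summable_nat_add_iff n).2 (hs y hy)
  have hsplit : ∀ n, S n = pathWeight a p n y * z ^ n + S (n + 1) := fun n => by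
    simp only [hS]
    rw [(hs' n).tsum_eq_zero_add, add_zero]
    congr 2; ext k; rw [show n + (k + 1) = n + 1 + k by ring]
  -- By the cocycle property the tail sum S_n is W_n(y) z^n times a full sum started at T^n y, hence
  -- at most A (S_n - S_{n+1}); so S contracts by 1 - 1/A.
  have hcoc : ∀ n, S n ≤ A * (pathWeight a p n y * z ^ n) := fun n => by
    have h1 : S n = pathWeight a p n y * z ^ n *
        ∑' k, pathWeight a p k ((T a)^[n] y) * z ^ k := by
      simp only [hS]
      rw [← tsum_mul_left]
      congr 1; ext k; rw [pathWeight_add, pow_add]; ring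
    rcases pathWeight_eq_zero_or_mem (p := p) ha ha1 hy n with h | h
    · rw [h1, h]; simp
    · rw [h1, mul_comm A]
      exact mul_le_mul_of_nonneg_left ((hs _ h).tsum_le_of_sum_range_le (hB _ h)) (hnn y n)
  have hSnn : ∀ n, 0 ≤ S n := fun n => tsum_nonneg fun k => hnn y _
  have h1A : 0 ≤ 1 - 1 / A := by
    rw [sub_nonneg, div_le_one (by linarith)]; exact hA.le
  have hdec : ∀ n, S n ≤ A * (1 - 1 / A) ^ n := by
    intro n
    induction n with
    | zero =>
      have := (hs y hy).tsum_le_of_sum_range_le (hB y hy)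
      simpa [hS] using this
    | succ n ih =>
      have h2 : S (n + 1) ≤ (1 - 1 / A) * S n := by
        have h3 := hcoc n
        have h4 := hsplit n
        have h5 : S n / A ≤ pathWeight a p n y * z ^ n := by
          rw [div_le_iff₀ (by linarith)]; linarith
        rw [sub_mul, one_div_mul_eq_div]; linarith
      calc _ ≤ _ := h2
        _ ≤ (1 - 1 / A) * (A * (1 - 1 / A) ^ n) := mul_le_mul_of_nonneg_left ih h1A
        _ = _ := by ring
  refine le_trans ?_ (hdec n)
  rw [hsplit]
  linarith [hSnn (n + 1)]

/-- The critical parameter: the reciprocal of the decay rate of the survival probabilities. -/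
theorem exists_critical (ha : 1 / 2 < a) (ha' : a ≤ 2 / 3) (hp : 0 < p) (hp' : p < 1) :
    ∃ z : ℝ, 0 < z ∧ HasSum (fun k => coef a p 0 k * z ^ (k + 1)) 1 ∧
      ∃ A ρ : ℝ, 0 < A ∧ 0 < ρ ∧ ρ < 1 ∧
        ∀ y ∈ stateSpace a, ∀ n, pathWeight a p n y * z ^ n ≤ A * ρ ^ n := by
  have ha0 : 0 < a := by linarith
  have ha1 : a < 1 := by linarith
  set M := 1 / (1 - a) with hM
  set Z : Set ℝ := {z | 0 ≤ z ∧ Summable fun n => survival a p n M * z ^ n} with hZ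
  have hVnn := fun n => survival_nonneg (a := a) hp.le hp'.le n M
  have hmono : ∀ z ∈ Z, ∀ w, 0 ≤ w → w ≤ z → w ∈ Z := fun z hz w hw hwz =>
    ⟨hw, Summable.of_nonneg_of_le (fun n => mul_nonneg (hVnn n) (by positivity))
      (fun n => mul_le_mul_of_nonneg_left (pow_le_pow_left₀ hw hwz n) (hVnn n)) hz.2⟩
  have hhalf : (1 / 2 : ℝ) ∈ Z := ⟨by norm_num, Summable.of_nonneg_of_le
    (fun n => mul_nonneg (hVnn n) (by positivity))
    (fun n => mul_le_of_le_one_left (by positivity) (survival_le_one hp.le hp'.le _ _))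
    (summable_geometric_of_lt_one (by norm_num) (by norm_num))⟩
  have hbdd : BddAbove Z := by
    refine ⟨1 / p, fun z hz => ?_⟩
    have h1 : Summable fun n : ℕ => (p * z) ^ n :=
      Summable.of_nonneg_of_le (fun n => pow_nonneg (mul_nonneg hp.le hz.1) n)
        (fun n => by
          rw [mul_pow]
          exact mul_le_mul_of_nonneg_right (pow_le_survival hp.le hp'.le n M)
            (pow_nonneg hz.1 n)) hz.2
    have h2 := summable_geometric_iff_norm_lt_one.1 h1
    rw [Real.norm_eq_abs, abs_of_nonneg (mul_nonneg hp.le hz.1)] at h2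
    rw [le_div_iff₀ hp]; linarith
  set z₀ := sSup Z with hz₀
  have hz₀pos : 0 < z₀ := lt_of_lt_of_le (by norm_num) (le_csSup hbdd hhalf)
  have hlt : ∀ z, 0 ≤ z → z < z₀ → z ∈ Z := fun z hz hzz => by
    obtain ⟨w, hw, hzw⟩ := exists_lt_of_lt_csSup ⟨_, hhalf⟩ hzz
    exact hmono w hw z hz hzw.le
  have hF : ∀ y ∈ stateSpace a, ∀ N,
      ∑ k ∈ Finset.range N, coef a p y k * z₀ ^ (k + 1) ≤ 1 := by
    intro y hy N
    have hc : Continuous fun z : ℝ => ∑ k ∈ Finset.range N, coef a p y k * z ^ (k + 1) := by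
      fun_prop
    refine le_of_tendsto ((hc.tendsto z₀).mono_left (nhdsWithin_le_nhds (s := Iio z₀))) ?_
    filter_upwards [Ioo_mem_nhdsLT hz₀pos] with z hz
    exact sum_coef_le_one ha ha' hp hp' hz.1.le (hlt z hz.1.le hz.2).2 hy N
  -- The term k = 0 is p z₀, and some later term is strictly positive, while the total is at most 1.
  have hpz : p * z₀ < 1 := by
    obtain ⟨k, hk1, hk⟩ := exists_coef_zero_pos (p := p) ha ha1 hp hp'
    have h1 := hF 0 (zero_mem ha1) (k + 1)
    rw [Finset.sum_range_succ] at h1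
    have h2 := Finset.single_le_sum (f := fun k => coef a p 0 k * z₀ ^ (k + 1))
      (fun k _ => mul_nonneg (coef_nonneg hp.le hp'.le _ _) (by positivity))
      (Finset.mem_range.2 hk1)
    simp only [coef_zero, delta, Function.iterate_zero, id, zero_lt_one, if_true, Nat.cast_one,
      one_mul, zero_add, pow_one] at h2
    have h3 : 0 < coef a p 0 k * z₀ ^ (k + 1) := by positivity
    linarith
  set A := (1 + (1 - p) / p * 1) / (1 - p * z₀) with hA
  have hA1 : 1 < A := by
    rw [hA, lt_div_iff₀ (by linarith)]
    have : 0 < (1 - p) / p := div_pos (by linarith) hp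
    nlinarith [mul_pos hp hz₀pos]
  have hdecay : ∀ y ∈ stateSpace a, ∀ n, pathWeight a p n y * z₀ ^ n ≤ A * (1 - 1 / A) ^ n :=
    fun y hy n => pathWeight_le_geometric ha0 ha1 hp hp' hz₀pos.le hA1
      (fun y hy => sum_pathWeight_le hp hp' hz₀pos.le hpz (hF y hy)) hy n
  set ρ := 1 - 1 / A with hρ
  have hρ0 : 0 < ρ := by
    rw [hρ, sub_pos, div_lt_one (by linarith)]; exact hA1
  have hρ1 : ρ < 1 := by
    rw [hρ]; have : 0 < 1 / A := by positivity
    linarith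
  refine ⟨z₀, hz₀pos, ?_, A, ρ, by linarith, hρ0, hρ1, hdecay⟩
  have hcoefle : ∀ y k, coef a p y k ≤ p * pathWeight a p k y := fun y k => by
    rw [coef, mul_assoc]
    refine mul_le_of_le_one_left (mul_nonneg hp.le (pathWeight_nonneg hp.le hp'.le _ _)) ?_
    unfold delta; split_ifs <;> simp
  have hsum : ∀ z, 0 ≤ z → z * ρ < z₀ → Summable fun k => coef a p 0 k * z ^ (k + 1) := by
    intro z hz hzρ
    refine Summable.of_nonneg_of_le
      (fun k => mul_nonneg (coef_nonneg hp.le hp'.le _ _) (by positivity)) (fun k => ?_)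
      ((summable_geometric_of_lt_one (r := z * ρ / z₀) (by positivity)
        ((div_lt_one hz₀pos).2 hzρ)).mul_left (p * A * z))
    calc coef a p 0 k * z ^ (k + 1) ≤ p * pathWeight a p k 0 * z ^ (k + 1) :=
          mul_le_mul_of_nonneg_right (hcoefle 0 k) (by positivity)
      _ = p * z * (z / z₀) ^ k * (pathWeight a p k 0 * z₀ ^ k) := by
          rw [div_pow]; field_simp; ring
      _ ≤ p * z * (z / z₀) ^ k * (A * ρ ^ k) :=
          mul_le_mul_of_nonneg_left (hdecay 0 (zero_mem ha1) k) (by positivity)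
      _ = _ := by rw [div_pow, div_pow, mul_pow]; ring
  have hs0 := hsum z₀ hz₀pos.le (by nlinarith)
  have hle1 := hs0.tsum_le_of_sum_range_le (hF 0 (zero_mem ha1))
  rcases hle1.lt_or_eq with hlt1 | heq
  swap
  · rw [← heq]; exact hs0.hasSum
  -- If the sum at z₀ were below 1, it would stay below 1 at some z > z₀ by continuity; the renewal
  -- equation would then put z in `Z`, contradicting the supremum.
  exfalso
  obtain ⟨z₁, hz01, hz1ρ⟩ : ∃ z₁, z₀ < z₁ ∧ z₁ * ρ < z₀ := by
    obtain ⟨z₁, h1, h2⟩ := exists_between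
      (show z₀ < z₀ / ρ by rw [lt_div_iff₀ hρ0]; nlinarith)
    exact ⟨z₁, h1, (lt_div_iff₀ hρ0).1 h2⟩
  have hz1 : 0 < z₁ := hz₀pos.trans hz01
  have hcont : ContinuousOn (fun z => ∑' k, coef a p 0 k * z ^ (k + 1)) (Icc 0 z₁) := by
    refine continuousOn_tsum (fun k => by fun_prop) (hsum z₁ hz1.le hz1ρ) fun k z hz => ?_
    rw [Real.norm_eq_abs, abs_of_nonneg
      (mul_nonneg (coef_nonneg hp.le hp'.le _ _) (pow_nonneg hz.1 _))]
    exact mul_le_mul_of_nonneg_left (pow_le_pow_left₀ hz.1 hz.2 _) (coef_nonneg hp.le hp'.le _ _)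
  have hev : ∀ᶠ z in 𝓝[>] z₀, ∑' k, coef a p 0 k * z ^ (k + 1) < 1 := by
    have h1 : ContinuousAt (fun z => ∑' k, coef a p 0 k * z ^ (k + 1)) z₀ :=
      hcont.continuousAt (Icc_mem_nhds hz₀pos hz01)
    exact (h1.tendsto.mono_left nhdsWithin_le_nhds).eventually (gt_mem_nhds hlt1)
  obtain ⟨z, hz, hzlt, hzz⟩ := (hev.and (Ioo_mem_nhdsGT hz01)).exists
  have hz0 : 0 < z := hz₀pos.trans hzlt
  have hzρ : z * ρ < z₀ := by nlinarith
  have hmem : z ∈ Z := by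
    refine ⟨hz0.le, summable_of_le_convolution_add
      (c := fun k => coef a p 0 k * z ^ (k + 1)) (g := fun n => pathWeight a p n 0 * z ^ n)
      (fun k => mul_nonneg (coef_nonneg hp.le hp'.le _ _) (by positivity))
      (fun n => mul_nonneg (hVnn n) (by positivity))
      (fun n => mul_nonneg (pathWeight_nonneg hp.le hp'.le _ _) (by positivity))
      (hsum z hz0.le hzρ).hasSum hz ?_ fun n => ?_⟩
    · refine Summable.of_nonneg_of_le
        (fun n => mul_nonneg (pathWeight_nonneg hp.le hp'.le _ _) (by positivity)) (fun n => ?_)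
        ((summable_geometric_of_lt_one (r := z * ρ / z₀) (by positivity)
          ((div_lt_one hz₀pos).2 hzρ)).mul_left A)
      calc pathWeight a p n 0 * z ^ n = (z / z₀) ^ n * (pathWeight a p n 0 * z₀ ^ n) := by
            rw [div_pow]; field_simp
        _ ≤ (z / z₀) ^ n * (A * ρ ^ n) :=
            mul_le_mul_of_nonneg_left (hdecay 0 (zero_mem ha1) n) (by positivity)
        _ = _ := by rw [div_pow, div_pow, mul_pow]; ring
    · rw [survival_eq ha ha' n (top_mem ha1), add_mul, Finset.sum_mul]
      refine add_le_add (le_of_eq (Finset.sum_congr rfl fun k hk => ?_)) ?_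
      · have hkn : (k + 1) + (n - 1 - k) = n := by have := Finset.mem_range.1 hk; omega
        calc _ = coef a p 0 k * survival a p (n - 1 - k) M * z ^ (k + 1 + (n - 1 - k)) := by
              rw [hkn]
          _ = _ := by rw [pow_add]; ring
      · refine mul_le_mul_of_nonneg_right (mul_le_of_le_one_right
          (pathWeight_nonneg hp.le hp'.le _ _) ?_) (by positivity)
        exact indicator_le_self' (fun _ _ => zero_le_one) _
  exact absurd (le_csSup hbdd hmem) (not_le.2 hzlt)

end

/-! ### Uniform convergence of the conditional tails -/

section

variable {a p : ℝ}

/-- The renewal sequence with interarrival probabilities `b`. -/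
def renewalSeq (b : ℕ → ℝ) : ℕ → ℝ
  | 0 => 1
  | n + 1 => ∑ k : Fin (n + 1), b k * renewalSeq b (n - k)

theorem renewalSeq_zero (b : ℕ → ℝ) : renewalSeq b 0 = 1 := by rw [renewalSeq]

theorem renewalSeq_succ (b : ℕ → ℝ) (n : ℕ) :
    renewalSeq b (n + 1) = ∑ k ∈ Finset.range (n + 1), b k * renewalSeq b (n - k) := by
  rw [renewalSeq, Finset.sum_range]

/-- Solutions of a renewal equation are convolutions with the renewal sequence. -/
theorem eq_sum_mul_renewalSeq {b g r : ℕ → ℝ}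
    (h : ∀ n, r n = ∑ k ∈ Finset.range n, b k * r (n - 1 - k) + g n) (n : ℕ) :
    r n = ∑ j ∈ Finset.range (n + 1), g j * renewalSeq b (n - j) := by
  induction n using Nat.strong_induction_on with
  | _ n ih =>
    rw [h n]
    rcases n with _ | n
    · simp [renewalSeq_zero]
    rw [Finset.sum_range_succ _ (n + 1), Nat.sub_self, renewalSeq_zero, mul_one]
    congr 1
    simp only [Nat.add_sub_cancel]
    have h1 : ∀ k ∈ Finset.range (n + 1), b k * r (n - k) =
        ∑ j ∈ Finset.range (n - k + 1), b k * (g j * renewalSeq b (n - k - j)) := fun k _ => by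
      rw [ih (n - k) (by omega), Finset.mul_sum]
    rw [Finset.sum_congr rfl h1, Finset.sum_comm' (t' := Finset.range (n + 1))
      (s' := fun j => Finset.range (n - j + 1))
      (by intro k j; simp only [Finset.mem_range]; omega)]
    refine Finset.sum_congr rfl fun j hj => ?_
    have hj' := Finset.mem_range.1 hj
    rw [show n + 1 - j = n - j + 1 by omega, renewalSeq_succ, Finset.mul_sum]
    refine Finset.sum_congr rfl fun k _ => ?_
    rw [show n - k - j = n - j - k by omega]; ring

theorem sum_pow_mul_pow_le {ρ γ : ℝ} (hρ : 0 ≤ ρ) (hργ : ρ < γ) (n : ℕ) :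
    ∑ k ∈ Finset.range (n + 1), ρ ^ k * γ ^ (n - k) ≤ γ ^ (n + 1) / (γ - ρ) := by
  have h := (Commute.all ρ γ).geom_sum₂_mul (n + 1)
  simp only [Nat.add_sub_cancel] at h
  rw [le_div_iff₀ (by linarith)]
  have : 0 ≤ ρ ^ (n + 1) := by positivity
  linarith

theorem abs_sub_le_of_abs_sub_succ_le {r : ℕ → ℝ} {K γ : ℝ} (hK : 0 ≤ K) (hγ : 0 ≤ γ) (hγ1 : γ < 1)
    (h : ∀ n, |r (n + 1) - r n| ≤ K * γ ^ n) {m n : ℕ} (hmn : m ≤ n) :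
    |r m - r n| ≤ K / (1 - γ) * γ ^ m := by
  obtain ⟨j, rfl⟩ := Nat.exists_eq_add_of_le hmn
  have h1 : 0 < 1 - γ := by linarith
  have key : |r m - r (m + j)| ≤ K / (1 - γ) * (γ ^ m - γ ^ (m + j)) := by
    clear hmn
    induction j with
    | zero => simp
    | succ j ih =>
      have h2 := h (m + j)
      have h3 : |r m - r (m + (j + 1))| ≤ |r m - r (m + j)| + |r (m + j + 1) - r (m + j)| := by
        rw [abs_sub_comm (r (m + j + 1))]; exact abs_sub_le _ _ _
      have h4 : K * γ ^ (m + j) = K / (1 - γ) * (γ ^ (m + j) - γ ^ (m + (j + 1))) := by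
        rw [← add_assoc, pow_succ]; field_simp
      linarith
  refine key.trans (mul_le_mul_of_nonneg_left ?_ (by positivity))
  have : 0 ≤ γ ^ (m + j) := by positivity
  linarith

/-- The error is the weighted sum of the differences r_{n-1-k} - r_n plus ε, divided by r_n ≥ c,
minus the tail of Σ t. Late values of r differ little, and for large k the weight t_k is small. -/
theorem abs_div_sub_tsum_le {t r : ℕ → ℝ} {A B K c ρ γ : ℝ} (hB : 0 ≤ B) (hK : 0 ≤ K) (hc : 0 < c)
    (hρ : 0 < ρ) (hργ : ρ < γ) (hγ1 : γ < 1) (ht : ∀ k, 0 ≤ t k) (htB : ∀ k, t k ≤ B * ρ ^ k)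
    (hr : ∀ n, c ≤ r n) (hrK : ∀ n, |r (n + 1) - r n| ≤ K * γ ^ n) (n : ℕ) {ε : ℝ}
    (hε : |ε| ≤ A * ρ ^ n) :
    |(∑ k ∈ Finset.range n, t k * r (n - 1 - k) + ε) / r n - ∑' k, t k| ≤
      ((B * (K / (1 - γ)) / (γ - ρ) + A) / c + B / (1 - ρ)) * γ ^ n := by
  have hγ : 0 < γ := hρ.trans hργ
  have h1γ : 0 < 1 - γ := by linarith
  have hργ' : 0 < γ - ρ := by linarith
  have h1ρ : 0 < 1 - ρ := by linarith
  have hpow : ρ ^ n ≤ γ ^ n := pow_le_pow_left₀ hρ.le hργ.le n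
  have hgeo := summable_geometric_of_lt_one hρ.le (by linarith : ρ < 1)
  have hts : Summable t := Summable.of_nonneg_of_le ht htB (hgeo.mul_left B)
  have hrn := hc.trans_le (hr n)
  have hA : 0 ≤ A := by
    have h0 : 0 ≤ A * ρ ^ n := (abs_nonneg _).trans hε
    exact nonneg_of_mul_nonneg_left h0 (by positivity)
  have htail0 : 0 ≤ ∑' k, t (k + n) := tsum_nonneg fun k => ht _
  have htail : ∑' k, t (k + n) ≤ B / (1 - ρ) * γ ^ n := by
    calc ∑' k, t (k + n) ≤ ∑' k, B * ρ ^ n * ρ ^ k := by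
          refine ((summable_nat_add_iff n).2 hts).tsum_le_tsum (fun k => ?_) (hgeo.mul_left _)
          rw [mul_assoc, ← pow_add, add_comm n]; exact htB _
      _ = B / (1 - ρ) * ρ ^ n := by
          rw [tsum_mul_left, tsum_geometric_of_lt_one hρ.le (by linarith)]; ring
      _ ≤ _ := mul_le_mul_of_nonneg_left hpow (by positivity)
  have hdiff : |∑ k ∈ Finset.range n, t k * (r (n - 1 - k) - r n)|
      ≤ B * (K / (1 - γ)) / (γ - ρ) * γ ^ n := by
    rcases n with _ | n
    · simp only [Finset.range_zero, Finset.sum_empty, abs_zero]; positivity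
    calc _ ≤ ∑ k ∈ Finset.range (n + 1), B * (K / (1 - γ)) * (ρ ^ k * γ ^ (n - k)) := by
          refine (Finset.abs_sum_le_sum_abs _ _).trans (Finset.sum_le_sum fun k _ => ?_)
          rw [abs_mul, abs_of_nonneg (ht k), Nat.add_sub_cancel]
          calc _ ≤ B * ρ ^ k * (K / (1 - γ) * γ ^ (n - k)) :=
                mul_le_mul (htB k)
                  (abs_sub_le_of_abs_sub_succ_le hK hγ.le hγ1 hrK (by omega))
                  (abs_nonneg _) (by positivity)
            _ = _ := by ring
      _ ≤ B * (K / (1 - γ)) * (γ ^ (n + 1) / (γ - ρ)) := by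
          rw [← Finset.mul_sum]
          exact mul_le_mul_of_nonneg_left (sum_pow_mul_pow_le hρ.le hργ n) (by positivity)
      _ = _ := by ring
  have hsplit := hts.sum_add_tsum_nat_add n
  have heq : (∑ k ∈ Finset.range n, t k * r (n - 1 - k) + ε) / r n - ∑' k, t k
      = (∑ k ∈ Finset.range n, t k * (r (n - 1 - k) - r n) + ε) / r n - ∑' k, t (k + n) := by
    rw [← hsplit]
    simp only [mul_sub, Finset.sum_sub_distrib, ← Finset.sum_mul]
    field_simp
    ring
  rw [heq]
  refine (abs_sub _ _).trans ?_
  rw [add_mul, abs_of_nonneg htail0, abs_div, abs_of_pos hrn]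
  refine add_le_add ?_ htail
  calc _ ≤ |∑ k ∈ Finset.range n, t k * (r (n - 1 - k) - r n) + ε| / c :=
        div_le_div_of_nonneg_left (abs_nonneg _) hc (hr n)
    _ ≤ (B * (K / (1 - γ)) / (γ - ρ) * γ ^ n + A * γ ^ n) / c := by
        refine div_le_div_of_nonneg_right ?_ hc.le
        exact (abs_add_le _ _).trans
          (add_le_add hdiff (hε.trans (mul_le_mul_of_nonneg_left hpow hA)))
    _ = _ := by ring

/-- Uniform exponential convergence of the conditional tails `ℙ_x(X_n > y ∣ τ > n)`. -/
theorem exists_uniform_convergence (ha : 1 / 2 < a) (ha' : a ≤ 2 / 3) (hp : 0 < p) (hp' : p < 1) :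
    ∃ z : ℝ, 0 < z ∧ HasSum (fun k => coef a p 0 k * z ^ (k + 1)) 1 ∧
      (∀ y ∈ stateSpace a, Summable fun k => coef a p y k * z ^ (k + 1)) ∧
      ∃ K γ : ℝ, 0 < K ∧ 0 < γ ∧ γ < 1 ∧ ∀ x ∈ stateSpace a, ∀ y ∈ stateSpace a, ∀ n,
        |(killed a p)^[n] ((Ioi y).indicator 1) x / survival a p n x
          - ∑' k, coef a p y k * z ^ (k + 1)| ≤ K * γ ^ n := by
  have ha1 : a < 1 := by linarith
  obtain ⟨z, hz, hsum, A, ρ, hA, hρ, hρ1, hdecay⟩ := exists_critical ha ha' hp hp'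
  have hpw := fun k y => pathWeight_nonneg (a := a) hp.le hp'.le k y
  have ht0 : ∀ y k, 0 ≤ coef a p y k * z ^ (k + 1) := fun y k =>
    mul_nonneg (coef_nonneg hp.le hp'.le _ _) (by positivity)
  have htB : ∀ y ∈ stateSpace a, ∀ k, coef a p y k * z ^ (k + 1) ≤ p * z * A * ρ ^ k := by
    intro y hy k
    have h1 : (delta a y k : ℝ) ≤ 1 := by unfold delta; split_ifs <;> simp
    calc coef a p y k * z ^ (k + 1)
        = delta a y k * (p * z * (pathWeight a p k y * z ^ k)) := by rw [coef, pow_succ]; ring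
      _ ≤ p * z * (pathWeight a p k y * z ^ k) :=
          mul_le_of_le_one_left
            (mul_nonneg (by positivity) (mul_nonneg (hpw _ _) (by positivity))) h1
      _ ≤ p * z * (A * ρ ^ k) := mul_le_mul_of_nonneg_left (hdecay y hy k) (by positivity)
      _ = _ := by ring
  have hgeo := summable_geometric_of_lt_one hρ.le hρ1
  refine ⟨z, hz, hsum, fun y hy =>
    Summable.of_nonneg_of_le (ht0 y) (htB y hy) (hgeo.mul_left _), ?_⟩
  set b : ℕ → ℝ := fun k => coef a p 0 k * z ^ (k + 1) with hb
  have hb0 : 0 < b 0 := by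
    simp only [hb, coef_zero, delta, Function.iterate_zero, id, zero_lt_one, if_true,
      Nat.cast_one, one_mul]
    positivity
  obtain ⟨⟨K₀, γ₀, hγ₀, hγ₀1, hK₀⟩, c, hc, hcu⟩ := renewal_exponential hρ hρ1 (ht0 0) hb0 hsum
    (htB 0 (zero_mem ha1)) (renewalSeq_zero b) (renewalSeq_succ b)
  have hK₀nn : 0 ≤ K₀ := by simpa using (abs_nonneg _).trans (hK₀ 0)
  -- γ strictly exceeds both rates, so that convolving ρ^k with γ^{n-k} costs only the factor γ/(γ -
  -- ρ).
  obtain ⟨γ, hγ, hγ1⟩ := exists_between (max_lt hρ1 hγ₀1)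
  obtain ⟨hργ, hγ₀γ⟩ := max_lt_iff.1 hγ
  have hγ0 : 0 < γ := hρ.trans hργ
  have hργ' : 0 < γ - ρ := by linarith
  have h1γ : 0 < 1 - γ := by linarith
  have h1ρ : 0 < 1 - ρ := by linarith
  have hK₀' : ∀ n, |renewalSeq b (n + 1) - renewalSeq b n| ≤ K₀ * γ ^ n := fun n =>
    (hK₀ n).trans (mul_le_mul_of_nonneg_left (pow_le_pow_left₀ hγ₀.le hγ₀γ.le n) hK₀nn)
  set K₁ := A * K₀ * (γ / (γ - ρ)) + A with hK₁
  have hK₁nn : 0 ≤ K₁ := by positivity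
  refine ⟨(p * z * A * (K₁ / (1 - γ)) / (γ - ρ) + A) / c + p * z * A / (1 - ρ), γ, by positivity,
    hγ0, hγ1, fun x hx y hy n => ?_⟩
  set r : ℕ → ℝ := fun n => survival a p n x * z ^ n with hr
  set g : ℕ → ℝ := fun n =>
    pathWeight a p n 0 * z ^ n * (Ici ((T a)^[n] 0)).indicator 1 x with hg
  have hind0 : ∀ s : Set ℝ, 0 ≤ s.indicator (1 : ℝ → ℝ) x := fun s =>
    indicator_nonneg (fun _ _ => zero_le_one) _
  have hind1 : ∀ s : Set ℝ, s.indicator (1 : ℝ → ℝ) x ≤ 1 := fun s =>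
    indicator_le_self' (fun _ _ => zero_le_one) _
  have hpz : ∀ y k, 0 ≤ pathWeight a p k y * z ^ k := fun y k =>
    mul_nonneg (hpw _ _) (by positivity)
  have hg0 : ∀ n, 0 ≤ g n := fun n => mul_nonneg (hpz _ _) (hind0 _)
  have hgA : ∀ n, g n ≤ A * ρ ^ n := fun n =>
    (mul_le_of_le_one_right (hpz _ _) (hind1 _)).trans (hdecay 0 (zero_mem ha1) n)
  have hscale : ∀ y n, (∑ k ∈ Finset.range n, coef a p y k * survival a p (n - 1 - k) x) * z ^ n
      = ∑ k ∈ Finset.range n, coef a p y k * z ^ (k + 1) * r (n - 1 - k) := by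
    intro y n
    rw [Finset.sum_mul]
    refine Finset.sum_congr rfl fun k hk => ?_
    have hkn : (k + 1) + (n - 1 - k) = n := by have := Finset.mem_range.1 hk; omega
    calc _ = coef a p y k * survival a p (n - 1 - k) x * z ^ (k + 1 + (n - 1 - k)) := by
          rw [hkn]
      _ = _ := by rw [pow_add]; ring
  have hren : ∀ n, r n = ∑ k ∈ Finset.range n, b k * r (n - 1 - k) + g n := by
    intro n
    simp only [hb, ← hscale, hg]
    simp only [hr]
    rw [survival_eq ha ha' n hx]; ring
  have hrsum := eq_sum_mul_renewalSeq hren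
  have hu0 : ∀ n, 0 ≤ renewalSeq b n := fun n => hc.le.trans (hcu n)
  have hrc : ∀ n, c ≤ r n := by
    intro n
    rw [hrsum]
    have h1 := Finset.single_le_sum (f := fun j => g j * renewalSeq b (n - j))
      (fun j _ => mul_nonneg (hg0 j) (hu0 _)) (Finset.mem_range.2 n.succ_pos)
    -- g_0 = 1 because x ≥ 0; the j = 0 term then gives r_n ≥ u_n ≥ c for all x at once.
    have h2 : g 0 = 1 := by simp [hg, pathWeight, hx.1]
    simp only [h2, one_mul, Nat.sub_zero] at h1
    exact (hcu n).trans h1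
  have hrK : ∀ n, |r (n + 1) - r n| ≤ K₁ * γ ^ n := by
    intro n
    rw [hrsum (n + 1), hrsum n, Finset.sum_range_succ _ (n + 1), Nat.sub_self, renewalSeq_zero,
      mul_one, add_sub_right_comm, ← Finset.sum_sub_distrib]
    refine (abs_add_le _ _).trans ?_
    rw [hK₁, add_mul]
    refine add_le_add ?_ ?_
    · calc _ ≤ ∑ k ∈ Finset.range (n + 1), A * K₀ * (ρ ^ k * γ ^ (n - k)) := by
            refine (Finset.abs_sum_le_sum_abs _ _).trans (Finset.sum_le_sum fun k hk => ?_)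
            have hkn : k < n + 1 := Finset.mem_range.1 hk
            rw [← mul_sub, abs_mul, abs_of_nonneg (hg0 k), show n + 1 - k = n - k + 1 by omega]
            calc _ ≤ A * ρ ^ k * (K₀ * γ ^ (n - k)) :=
                  mul_le_mul (hgA k) (hK₀' _) (abs_nonneg _) (by positivity)
              _ = _ := by ring
        _ ≤ A * K₀ * (γ ^ (n + 1) / (γ - ρ)) := by
            rw [← Finset.mul_sum]
            exact mul_le_mul_of_nonneg_left (sum_pow_mul_pow_le hρ.le hργ n) (by positivity)
        _ = _ := by rw [pow_succ]; ring
    · rw [abs_of_nonneg (hg0 _)]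
      refine (hgA _).trans (mul_le_mul_of_nonneg_left ?_ hA.le)
      calc ρ ^ (n + 1) ≤ ρ ^ n := pow_le_pow_of_le_one hρ.le hρ1.le n.le_succ
        _ ≤ γ ^ n := pow_le_pow_left₀ hρ.le hργ.le n
  have hfrac : (killed a p)^[n] ((Ioi y).indicator 1) x / survival a p n x
      = (∑ k ∈ Finset.range n, coef a p y k * z ^ (k + 1) * r (n - 1 - k)
        + pathWeight a p n y * z ^ n * (Ioi ((T a)^[n] y)).indicator 1 x) / r n := by
    rw [← hscale, killed_iterate_indicator_Ioi ha ha' n hy hx,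
      ← mul_div_mul_right _ _ (pow_ne_zero n hz.ne')]
    congr 1
    ring
  rw [hfrac]
  refine abs_div_sub_tsum_le (by positivity) hK₁nn hc hρ hργ hγ1 (ht0 y) (htB y hy) hrc hrK n ?_
  rw [abs_of_nonneg (mul_nonneg (hpz _ _) (hind0 _))]
  exact (mul_le_of_le_one_right (hpz _ _) (hind1 _)).trans (hdecay y hy n)

end

/-! ### From uniform tail bounds to functions of bounded variation -/

section

theorem tendsto_measureReal_Ioi_sub (μ : Measure ℝ) [IsProbabilityMeasure μ] (y : ℝ) :
    Tendsto (fun n : ℕ => μ.real (Ioi (y - 1 / ((n : ℝ) + 1)))) atTop (𝓝 (μ.real (Ici y))) := by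
  have h1 : ⋂ n : ℕ, Ioi (y - 1 / ((n : ℝ) + 1)) = Ici y := by
    ext x
    simp only [mem_iInter, mem_Ioi, mem_Ici]
    refine ⟨fun h => ?_, fun h n => ?_⟩
    · by_contra! hx
      obtain ⟨n, hn⟩ := exists_nat_one_div_lt (sub_pos.2 hx)
      linarith [h n]
    · have : (0 : ℝ) < 1 / ((n : ℝ) + 1) := by positivity
      linarith
  rw [← h1]
  refine (ENNReal.tendsto_toReal (measure_ne_top _ _)).comp
    (tendsto_measure_iInter_atTop (fun n => measurableSet_Ioi.nullMeasurableSet) ?_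
      ⟨0, measure_ne_top _ _⟩)
  intro m n hmn
  refine Ioi_subset_Ioi ?_
  have : 1 / ((n : ℝ) + 1) ≤ 1 / ((m : ℝ) + 1) := by gcongr
  linarith

variable {μ ν : Measure ℝ} [IsProbabilityMeasure μ] [IsProbabilityMeasure ν] {ε : ℝ}

/-- An upper set of ℝ is empty, everything, or an open or closed half-line, and a closed one is a
decreasing limit of open ones. Superlevel sets of monotone functions have this form. -/
theorem abs_measureReal_sub_le_of_isUpperSet
    (h : ∀ y, |μ.real (Ioi y) - ν.real (Ioi y)| ≤ ε) {U : Set ℝ} (hU : IsUpperSet U) :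
    |μ.real U - ν.real U| ≤ ε := by
  have hε : 0 ≤ ε := (abs_nonneg _).trans (h 0)
  rcases U.eq_empty_or_nonempty with rfl | hne
  · simpa
  by_cases hb : BddBelow U
  · have h1 : Ioi (sInf U) ⊆ U := fun x hx => by
      obtain ⟨u, hu, hux⟩ := exists_lt_of_csInf_lt hne hx
      exact hU hux.le hu
    have h2 : U ⊆ Ici (sInf U) := fun x hx => csInf_le hb hx
    by_cases hm : sInf U ∈ U
    · have : U = Ici (sInf U) := h2.antisymm fun x hx => hU hx hm
      rw [this]
      exact le_of_tendsto ((tendsto_measureReal_Ioi_sub μ _).sub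
        (tendsto_measureReal_Ioi_sub ν _)).abs (Eventually.of_forall fun n => h _)
    · have : U = Ioi (sInf U) := Subset.antisymm
        (fun x hx => lt_of_le_of_ne (h2 hx) fun he : sInf U = x => hm (by rwa [he])) h1
      rw [this]; exact h _
  · have : U = univ := eq_univ_of_forall fun x => by
      obtain ⟨u, hu, hux⟩ := not_bddBelow_iff.1 hb x
      exact hU hux.le hu
    simpa [this] using hε

/-- By the layer-cake formula both integrals are m plus an integral over levels in (0, D], and at
each level the measures of the superlevel sets differ by at most ε. -/
theorem abs_integral_sub_le_of_monotone
    (h : ∀ y, |μ.real (Ioi y) - ν.real (Ioi y)| ≤ ε) {g : ℝ → ℝ} (hg : Monotone g) {m D : ℝ}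
    (hm : ∀ x, m ≤ g x) (hD : ∀ x, g x ≤ m + D) :
    |∫ x, g x ∂μ - ∫ x, g x ∂ν| ≤ ε * D := by
  have hD0 : 0 ≤ D := by linarith [hm 0, hD 0]
  have hint : ∀ (κ : Measure ℝ) [IsProbabilityMeasure κ], Integrable g κ := fun κ _ =>
    Integrable.of_bound hg.measurable.aestronglyMeasurable (|m| + D)
      (Eventually.of_forall fun x => by
        rw [Real.norm_eq_abs, abs_le]
        constructor <;> linarith [hm x, hD x, neg_abs_le m, le_abs_self m])
  have hlayer : ∀ (κ : Measure ℝ) [IsProbabilityMeasure κ],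
      ∫ x, g x ∂κ = m + ∫ t in Ioc 0 D, κ.real {x | t ≤ g x - m} := fun κ _ => by
    have h1 : Integrable (fun x => g x - m) κ := (hint κ).sub (integrable_const m)
    rw [← h1.integral_eq_integral_Ioc_meas_le
      (Eventually.of_forall fun x => sub_nonneg.2 (hm x))
      (Eventually.of_forall fun x => by linarith [hD x]),
      integral_sub (hint κ) (integrable_const m)]
    simp
  have hanti : ∀ (κ : Measure ℝ) [IsProbabilityMeasure κ],
      IntegrableOn (fun t => κ.real {x | t ≤ g x - m}) (Ioc 0 D) := fun κ _ => by
    refine Measure.integrableOn_of_bounded (M := 1) (by simp) ?_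
      (Eventually.of_forall fun t => by
        rw [Real.norm_eq_abs, abs_of_nonneg measureReal_nonneg]; exact measureReal_le_one)
    have h1 : Antitone fun t => κ.real {x | t ≤ g x - m} := fun s t hst =>
      measureReal_mono fun x (hx : t ≤ g x - m) => hst.trans hx
    exact h1.measurable.aestronglyMeasurable
  rw [hlayer μ, hlayer ν, add_sub_add_left_eq_sub, ← integral_sub (hanti μ) (hanti ν),
    ← Real.norm_eq_abs]
  refine (norm_setIntegral_le_of_norm_le_const (C := ε) (by simp) fun t _ => ?_).trans ?_
  · rw [Real.norm_eq_abs]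
    refine abs_measureReal_sub_le_of_isUpperSet h fun x y hxy hx => ?_
    have := hg hxy
    simp only [mem_ofPred_eq] at hx ⊢
    linarith
  · simp [hD0]

/-- A bound on the difference of integrals of a function of bounded variation by the Kolmogorov
distance. -/
theorem abs_integral_sub_le_of_boundedVariationOn {M : ℝ} (hM : 0 ≤ M)
    (h : ∀ y, |μ.real (Ioi y) - ν.real (Ioi y)| ≤ ε) {f : ℝ → ℝ}
    (hf : BoundedVariationOn f (Icc 0 M)) :
    Measurable (fun x => f (projIcc 0 M hM x)) ∧
    |∫ x, f (projIcc 0 M hM x) ∂μ - ∫ x, f (projIcc 0 M hM x) ∂ν|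
      ≤ 3 * ε * (eVariationOn f (Icc 0 M)).toReal := by
  set W := (eVariationOn f (Icc 0 M)).toReal with hW
  have h0 : (0 : ℝ) ∈ Icc 0 M := ⟨le_rfl, hM⟩
  have hMm : M ∈ Icc 0 M := ⟨hM, le_rfl⟩
  have hproj : Monotone fun x => (projIcc 0 M hM x : ℝ) := fun x y hxy => monotone_projIcc hM hxy
  set V : ℝ → ℝ := fun x => variationOnFromTo f (Icc 0 M) 0 x with hV
  have hVm : MonotoneOn V (Icc 0 M) :=
    variationOnFromTo.monotoneOn hf.locallyBoundedVariationOn h0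
  have hVfm : MonotoneOn (fun x => V x - f x) (Icc 0 M) :=
    variationOnFromTo.sub_self_monotoneOn hf.locallyBoundedVariationOn h0
  have hV0 : ∀ x ∈ Icc 0 M, 0 ≤ V x := fun x hx => variationOnFromTo.nonneg_of_le _ _ hx.1
  have hVW : ∀ x ∈ Icc 0 M, V x ≤ W := fun x hx => by
    simp only [hV, variationOnFromTo.eq_of_le f _ hx.1]
    exact ENNReal.toReal_mono hf (eVariationOn.mono _ inter_subset_left)
  have g1 : Monotone fun x => V (projIcc 0 M hM x) := fun x y hxy =>
    hVm (projIcc 0 M hM x).2 (projIcc 0 M hM y).2 (hproj hxy)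
  have g2 : Monotone fun x => V (projIcc 0 M hM x) - f (projIcc 0 M hM x) := fun x y hxy =>
    hVfm (projIcc 0 M hM x).2 (projIcc 0 M hM y).2 (hproj hxy)
  have hVzero : V 0 = 0 := variationOnFromTo.self _ _ _
  have b1 := abs_integral_sub_le_of_monotone h g1 (m := 0) (D := W) (fun x => hV0 _ (projIcc 0 M hM x).2)
    (fun x => by rw [zero_add]; exact hVW _ (projIcc 0 M hM x).2)
  -- f = V - (V - f) with both parts monotone; V ranges over at most W and V - f over at most 2W,
  -- whence the factor 3.
  have b2 := abs_integral_sub_le_of_monotone h g2 (m := V 0 - f 0) (D := 2 * W)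
    (fun x => hVfm h0 (projIcc 0 M hM x).2 (projIcc 0 M hM x).2.1)
    (fun x => by
      refine (hVfm (projIcc 0 M hM x).2 hMm (projIcc 0 M hM x).2.2).trans ?_
      have h1 := hVW M hMm
      have h2 := hf.sub_le h0 hMm
      simp only
      linarith)
  have hbd : ∀ (κ : Measure ℝ) [IsProbabilityMeasure κ] {g : ℝ → ℝ}, Monotone g → ∀ m D : ℝ,
      (∀ x, m ≤ g x) → (∀ x, g x ≤ D) → Integrable g κ := fun κ _ g hg m D hm hD =>
    Integrable.of_bound hg.measurable.aestronglyMeasurable (|m| + |D|)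
      (Eventually.of_forall fun x => by
        rw [Real.norm_eq_abs, abs_le]
        constructor <;> linarith [hm x, hD x, neg_abs_le m, le_abs_self D, abs_nonneg m, abs_nonneg D])
  have i1 : ∀ (κ : Measure ℝ) [IsProbabilityMeasure κ],
      Integrable (fun x => V (projIcc 0 M hM x)) κ := fun κ _ =>
    hbd κ g1 0 W (fun x => hV0 _ (projIcc 0 M hM x).2) (fun x => hVW _ (projIcc 0 M hM x).2)
  have i2 : ∀ (κ : Measure ℝ) [IsProbabilityMeasure κ],
      Integrable (fun x => V (projIcc 0 M hM x) - f (projIcc 0 M hM x)) κ := fun κ _ =>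
    hbd κ g2 (V 0 - f 0) (V M - f M)
      (fun x => hVfm h0 (projIcc 0 M hM x).2 (projIcc 0 M hM x).2.1)
      (fun x => hVfm (projIcc 0 M hM x).2 hMm (projIcc 0 M hM x).2.2)
  have heq : (fun x => f (projIcc 0 M hM x)) = fun x =>
      V (projIcc 0 M hM x) - (V (projIcc 0 M hM x) - f (projIcc 0 M hM x)) := by
    ext x; ring
  refine ⟨by rw [heq]; exact g1.measurable.sub g2.measurable, ?_⟩
  rw [heq, integral_sub (i1 μ) (i2 μ), integral_sub (i1 ν) (i2 ν)]
  rw [abs_le] at *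
  constructor <;> linarith [b1.1, b1.2, b2.1, b2.2]

end

/-! ### Construction of the limit law and uniqueness of the rate -/

section

variable {a p : ℝ}

theorem antitone_killed_iterate_indicator_Ioi (hp : 0 ≤ p) (hp' : p ≤ 1) (n : ℕ) (x : ℝ) :
    Antitone fun y => (killed a p)^[n] ((Ioi y).indicator 1) x := fun _ _ h =>
  killed_iterate_mono hp hp' n
    (indicator_le_indicator_of_subset (Ioi_subset_Ioi h) fun _ => zero_le_one) x

/-- The induction goes through because the survival condition 1 ≤ ax does not involve y. -/
theorem continuousWithinAt_killed_iterate_indicator_Ioi (n : ℕ) (x y : ℝ) :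
    ContinuousWithinAt (fun y => (killed a p)^[n] ((Ioi y).indicator 1) x) (Ici y) y := by
  induction n generalizing x with
  | zero =>
    simp only [Function.iterate_zero, id]
    rcases lt_or_ge y x with h | h
    · have : (fun y => (Ioi y).indicator (1 : ℝ → ℝ) x) =ᶠ[𝓝 y] fun _ => 1 := by
        filter_upwards [Iio_mem_nhds h] with w hw
        exact indicator_of_mem (mem_Ioi.2 hw) _
      exact (continuousAt_const.congr this.symm).continuousWithinAt
    · refine (continuousWithinAt_const (b := (0 : ℝ))).congr (fun w hw => ?_) ?_
      · exact indicator_of_notMem (not_lt.2 (h.trans hw)) _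
      · exact indicator_of_notMem (not_lt.2 h) _
  | succ n ih =>
    simp only [Function.iterate_succ_apply', killed]
    refine (continuousWithinAt_const.mul (ih _)).add (continuousWithinAt_const.mul ?_)
    split_ifs
    exacts [ih _, continuousWithinAt_const]

theorem survival_pos (hp : 0 < p) (hp' : p ≤ 1) (n : ℕ) (x : ℝ) : 0 < survival a p n x :=
  (pow_pos hp n).trans_le (pow_le_survival hp.le hp' n x)

theorem killed_iterate_indicator_Ioi_of_neg (ha : 0 ≤ a) (ha1 : a < 1) (n : ℕ) {x y : ℝ}
    (hx : x ∈ stateSpace a) (hy : y < 0) :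
    (killed a p)^[n] ((Ioi y).indicator 1) x = survival a p n x :=
  killed_iterate_congr ha ha1 n (fun _ hz => indicator_of_mem (hy.trans_le hz.1) _) hx

theorem killed_iterate_indicator_Ioi_of_ge (ha : 0 ≤ a) (ha1 : a < 1) (n : ℕ) {x y : ℝ}
    (hx : x ∈ stateSpace a) (hy : 1 / (1 - a) ≤ y) :
    (killed a p)^[n] ((Ioi y).indicator 1) x = 0 := by
  have h0 : (killed a p)^[n] (fun _ => 0) = fun _ => 0 := by
    simpa using killed_iterate_linear (a := a) (p := p) n 0 0 (fun _ => 0) (fun _ => 0)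
  have h1 : EqOn ((Ioi y).indicator (1 : ℝ → ℝ)) (fun _ => 0) (stateSpace a) := fun z hz =>
    indicator_of_notMem (not_lt.2 (hz.2.trans hy)) _
  rw [killed_iterate_congr ha ha1 n h1 hx, h0]

/-- Existence of the limit law, with uniform exponential convergence of the conditional tails. -/
theorem exists_limitLaw (ha : 1 / 2 < a) (ha' : a ≤ 2 / 3) (hp : 0 < p) (hp' : p < 1) :
    ∃ lam : ℝ, IsRate a p lam ∧ ∃ ν : Measure ℝ, IsLimitLaw a p lam ν ∧
      ∃ K γ : ℝ, 0 < K ∧ 0 < γ ∧ γ < 1 ∧ ∀ x ∈ stateSpace a, ∀ y : ℝ, ∀ n,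
        |(killed a p)^[n] ((Ioi y).indicator 1) x / survival a p n x - ν.real (Ioi y)|
          ≤ K * γ ^ n := by
  have ha0 : 0 ≤ a := by linarith
  have ha1 : a < 1 := by linarith
  obtain ⟨z, hz, hsum, hsummable, K, γ, hK, hγ, hγ1, hconv⟩ :=
    exists_uniform_convergence ha ha' hp hp'
  set M := 1 / (1 - a) with hM
  set H : ℕ → ℝ → ℝ := fun n y =>
    1 - (killed a p)^[n] ((Ioi y).indicator 1) 0 / survival a p n 0 with hH
  set G : ℝ → ℝ := fun y =>
    if y < 0 then 0 else if M ≤ y then 1 else 1 - ∑' k, coef a p y k * z ^ (k + 1) with hG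
  have h0 := zero_mem ha1
  have hdist : ∀ x ∈ stateSpace a, ∀ y n,
      |(killed a p)^[n] ((Ioi y).indicator 1) x / survival a p n x - (1 - G y)| ≤ K * γ ^ n := by
    intro x hx y n
    have hpos := survival_pos (a := a) hp hp'.le n x
    have hnn : 0 ≤ K * γ ^ n := by positivity
    simp only [hG]
    split_ifs with h1 h2
    · rw [killed_iterate_indicator_Ioi_of_neg ha0 ha1 n hx h1, div_self hpos.ne']
      simpa using hnn
    · rw [killed_iterate_indicator_Ioi_of_ge ha0 ha1 n hx h2]
      simpa using hnn
    · rw [sub_sub_cancel]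
      exact hconv x hx y ⟨not_lt.1 h1, (not_le.1 h2).le⟩ n
  have hlim : Tendsto (fun n : ℕ => K * γ ^ n) atTop (𝓝 0) := by
    simpa using (tendsto_pow_atTop_nhds_zero_of_lt_one hγ.le hγ1).const_mul K
  have hHG : ∀ y n, |H n y - G y| ≤ K * γ ^ n := fun y n => by
    rw [abs_sub_comm]
    convert hdist 0 h0 y n using 2
    simp only [hH]; ring
  have htend : ∀ y, Tendsto (fun n => H n y) atTop (𝓝 (G y)) := fun y =>
    tendsto_iff_norm_sub_tendsto_zero.2
      (squeeze_zero (fun n => norm_nonneg _) (fun n => hHG y n) hlim)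
  have hmono : Monotone G := fun y w hyw => le_of_tendsto_of_tendsto' (htend y) (htend w) fun n =>
    sub_le_sub_left (div_le_div_of_nonneg_right
      (antitone_killed_iterate_indicator_Ioi hp.le hp'.le n 0 hyw)
      (survival_nonneg hp.le hp'.le n 0)) 1
  have hunif : TendstoUniformly H G atTop := by
    rw [Metric.tendstoUniformly_iff]
    intro ε hε
    filter_upwards [hlim.eventually (gt_mem_nhds hε)] with n hn y
    rw [dist_comm, Real.dist_eq]
    exact (hHG y n).trans_lt hn
  -- Right continuity survives the uniform limit, so it need not be read off the series.
  have hrc : ∀ y, ContinuousWithinAt G (Ici y) y := fun y => by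
    refine continuousWithinAt_of_locally_uniform_approx_of_continuousWithinAt self_mem_Ici
      fun u hu => ?_
    obtain ⟨n, hn⟩ := (hunif u hu).exists
    exact ⟨univ, univ_mem, H n, continuousWithinAt_const.sub
      ((continuousWithinAt_killed_iterate_indicator_Ioi n 0 y).div_const _), fun y _ => hn y⟩
  set F : StieltjesFunction ℝ := ⟨G, hmono, hrc⟩ with hF
  have hbot : Tendsto F atBot (𝓝 0) := by
    refine tendsto_const_nhds.congr' ?_
    filter_upwards [Iio_mem_atBot (0 : ℝ)] with y hy
    exact (if_pos hy).symm
  have hMpos : 0 ≤ M := h0.2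
  have hGM : ∀ y, M ≤ y → G y = 1 := fun y hy => by
    simp only [hG]
    rw [if_neg (not_lt.2 (hMpos.trans hy)), if_pos hy]
  have htop : Tendsto F atTop (𝓝 1) := by
    refine tendsto_const_nhds.congr' ?_
    filter_upwards [Ici_mem_atTop M] with y hy
    exact (hGM y hy).symm
  have hprob : IsProbabilityMeasure F.measure := F.isProbabilityMeasure hbot htop
  have hIic : ∀ y, F.measure (Iic y) = ENNReal.ofReal (G y) := fun y => by
    rw [F.measure_Iic hbot, sub_zero]
  have hG0 : ∀ y, 0 ≤ G y := fun y => by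
    rcases lt_or_ge y 0 with h | h
    · exact (if_pos h).ge
    · have h1 : G (-1) ≤ G y := hmono (by linarith)
      have h2 : G (-1) = 0 := if_pos (by norm_num)
      rwa [h2] at h1
  have hIicr : ∀ y, F.measure.real (Iic y) = G y := fun y => by
    rw [measureReal_def, hIic, ENNReal.toReal_ofReal (hG0 y)]
  have hGS : ∀ y ∈ stateSpace a, G y = 1 - ∑' k, coef a p y k * z ^ (k + 1) := fun y hy => by
    rcases lt_or_ge y M with h | h
    · simp only [hG]
      rw [if_neg (not_lt.2 hy.1), if_neg (not_le.2 h)]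
    · have h1 : ∀ n, |∑' k, coef a p y k * z ^ (k + 1)| ≤ K * γ ^ n := fun n => by
        have := hconv 0 h0 y hy n
        rwa [killed_iterate_indicator_Ioi_of_ge ha0 ha1 n h0 h, zero_div, zero_sub, abs_neg] at this
      rw [hGM y h, abs_nonpos_iff.1 (ge_of_tendsto' hlim h1), sub_zero]
  have hterm : ∀ y, term a p (1 / z) y = fun k => coef a p y k * z ^ (k + 1) := fun y => by
    ext k
    rw [term_eq hp.ne', one_div_one_div]
  have hIoi : ∀ y, F.measure.real (Ioi y) = 1 - G y := fun y => by
    rw [← compl_Iic, probReal_compl_eq_one_sub measurableSet_Iic, hIicr]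
  refine ⟨1 / z, ⟨by positivity, by rwa [hterm]⟩, F.measure, ⟨hprob, ?_, ?_, ?_⟩,
    K, γ, hK, hγ, hγ1, ?_⟩
  · have h1 : F.measure (Iic 0) = 0 := by
      rw [hIic, hGS 0 h0, hsum.tsum_eq, sub_self, ENNReal.ofReal_zero]
    have h2 : F.measure (Ioi M) = 0 := by
      rw [← measureReal_eq_zero_iff, hIoi, hGM M le_rfl, sub_self]
    refine measure_mono_null (fun y hy => ?_) (measure_union_null h1 h2)
    by_contra! h
    rw [mem_union, not_or] at h
    exact hy ⟨(not_le.1 h.1).le, not_lt.1 h.2⟩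
  · intro y hy
    rw [hterm]; exact hsummable y hy
  · intro y hy
    rw [hterm, hIicr, hGS y hy]
  · intro x hx y n
    rw [hIoi]
    exact hdist x hx y n

/-- Every term is nonincreasing in λ, and the k = 0 term p/λ is strictly decreasing. -/
theorem IsRate.unique (hp : 0 < p) (hp' : p < 1) {l₁ l₂ : ℝ} (h₁ : IsRate a p l₁)
    (h₂ : IsRate a p l₂) : l₁ = l₂ := by
  have key : ∀ l₁ l₂ : ℝ, IsRate a p l₁ → IsRate a p l₂ → ¬ l₁ < l₂ := by
    intro l₁ l₂ h₁ h₂ hlt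
    have hinv : 1 / l₂ < 1 / l₁ := one_div_lt_one_div_of_lt h₁.1 hlt
    have hpos : 0 < 1 / l₂ := one_div_pos.2 h₂.1
    refine lt_irrefl (1 : ℝ) (hasSum_lt (f := term a p l₂ 0) (g := term a p l₁ 0) (i := 0)
      (fun k => ?_) ?_ h₂.2 h₁.2)
    · rw [term_eq hp.ne', term_eq hp.ne']
      exact mul_le_mul_of_nonneg_left (pow_le_pow_left₀ hpos.le hinv.le _)
        (coef_nonneg hp.le hp'.le _ _)
    · rw [term_eq hp.ne', term_eq hp.ne']
      simp only [coef_zero, delta, Function.iterate_zero, id, zero_lt_one, if_true, Nat.cast_one,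
        one_mul, zero_add, pow_one]
      exact mul_lt_mul_of_pos_left hinv hp
  rcases lt_trichotomy l₁ l₂ with h | h | h
  · exact absurd h (key _ _ h₁ h₂)
  · exact h
  · exact absurd h (key _ _ h₂ h₁)

end

/-! ### The chain on survival and the killed kernel -/

section

variable {a p x : ℝ}

theorem lt_exitTime_iff (ξ : ℕ → ℝ) (n : ℕ) :
    (n : ℕ∞) < exitTime a x ξ ↔ ∀ k ≤ n, 0 ≤ chain a x ξ k := by
  rw [← ENat.add_one_le_iff (ENat.natCast_ne_top n), exitTime]
  simp only [le_iInf_iff]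
  refine forall_congr' fun k => ?_
  have : ((n : ℕ∞) + 1 ≤ k) ↔ n + 1 ≤ k := by exact_mod_cast Iff.rfl
  rw [this]
  refine ⟨fun h hk => ?_, fun h hk => ?_⟩
  · by_contra! h0
    have := h h0
    omega
  · by_contra! h0
    exact absurd (h (by omega)) (not_le.2 hk)

/-- The information contained in the first `n` innovations. -/
@[reducible] def history {Ω : Type*} (ξ : ℕ → Ω → ℝ) (n : ℕ) : MeasurableSpace Ω :=
  ⨆ i ∈ Iio n, MeasurableSpace.comap (ξ (i + 1)) inferInstance

theorem history_mono {Ω : Type*} (ξ : ℕ → Ω → ℝ) {m n : ℕ} (h : m ≤ n) : history ξ m ≤ history ξ n :=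
  biSup_mono fun _ hi => lt_of_lt_of_le hi h

section Probability

variable {Ω : Type*} {ξ : ℕ → Ω → ℝ}

/-- The event that the chain stays nonnegative up to time `n`. -/
def alive (a x : ℝ) (ξ : ℕ → Ω → ℝ) (n : ℕ) : Set Ω :=
  {ω | ∀ k ≤ n, 0 ≤ chain a x (fun k => ξ k ω) k}

theorem measurable_chain_history (n : ℕ) :
    Measurable[history ξ n] fun ω => chain a x (fun k => ξ k ω) n := by
  induction n with
  | zero => exact measurable_const
  | succ n ih =>
    have h1 : Measurable[history ξ (n + 1)] fun ω => chain a x (fun k => ξ k ω) n :=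
      ih.mono (history_mono ξ n.le_succ) le_rfl
    have h2 : Measurable[history ξ (n + 1)] (ξ (n + 1)) :=
      (comap_measurable (ξ (n + 1))).mono (le_biSup (fun i => MeasurableSpace.comap (ξ (i + 1))
        inferInstance) (show n ∈ Iio (n + 1) from n.lt_succ_self)) le_rfl
    exact (measurable_const.mul h1).add h2

theorem measurableSet_alive_history (n : ℕ) : MeasurableSet[history ξ n] (alive a x ξ n) := by
  have : alive a x ξ n = ⋂ k, ⋂ (_ : k ≤ n), {ω | 0 ≤ chain a x (fun k => ξ k ω) k} := by
    ext ω; simp [alive]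
  rw [this]
  refine MeasurableSet.iInter fun k => MeasurableSet.iInter fun hk => ?_
  exact (measurable_chain_history k).mono (history_mono ξ hk) le_rfl measurableSet_Ici

variable [mΩ : MeasurableSpace Ω] {P : Measure Ω}

theorem IsInnovation.history_le (h : IsInnovation P p ξ) (n : ℕ) : history ξ n ≤ mΩ :=
  iSup₂_le fun i _ => (h.measurable (i + 1) (by omega)).comap_le

theorem IsInnovation.indepFun (h : IsInnovation P p ξ) (n : ℕ) {g : Ω → ℝ}
    (hg : Measurable[history ξ n] g) : IndepFun (ξ (n + 1)) g P := by
  rw [IndepFun_iff_Indep]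
  have h1 := indep_iSup_of_disjoint (m := fun i => MeasurableSpace.comap (ξ (i + 1)) inferInstance)
    (fun i => (h.measurable (i + 1) (by omega)).comap_le) h.indep
    -- Indices are shifted by one: n stands for `ξ (n + 1)`, and `Iio n` for ξ_1, …, ξ_n.
    (S := {n}) (T := Iio n) (by simp)
  rw [iSup_singleton] at h1
  exact indep_of_indep_of_le_right h1 hg.comap_le

theorem IsInnovation.ae_eq_one_or [IsProbabilityMeasure P] (h : IsInnovation P p ξ) (hp : 0 ≤ p)
    (hp' : p ≤ 1) (n : ℕ) : ∀ᵐ ω ∂P, ξ (n + 1) ω = 1 ∨ ξ (n + 1) ω = -1 := by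
  have hm := h.measurable (n + 1) (by omega)
  have h1 : MeasurableSet {ω | ξ (n + 1) ω = 1} := hm (measurableSet_singleton 1)
  have h2 : MeasurableSet {ω | ξ (n + 1) ω = -1} := hm (measurableSet_singleton (-1))
  have hd : Disjoint {ω | ξ (n + 1) ω = 1} {ω | ξ (n + 1) ω = -1} := by
    rw [Set.disjoint_left]
    intro ω (hω : _ = _) (hω' : _ = _)
    rw [hω] at hω'
    norm_num at hω'
  have h3 : P ({ω | ξ (n + 1) ω = 1} ∪ {ω | ξ (n + 1) ω = -1}) = 1 := by
    rw [measure_union hd h2, h.prob_one _ (by omega), h.prob_neg_one _ (by omega),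
      ← ENNReal.ofReal_add hp (by linarith)]
    simp
  exact (prob_compl_eq_zero_iff (h1.union h2)).2 h3

/-- The expectation of a function of the chain on survival is given by the killed kernel. -/
theorem IsInnovation.integral_alive [IsProbabilityMeasure P] (h : IsInnovation P p ξ)
    (ha : 0 ≤ a) (hp : 0 ≤ p) (hp' : p ≤ 1) (hx : 0 ≤ x) (n : ℕ) {f : ℝ → ℝ} (hf : Measurable f)
    {B : ℝ} (hB : ∀ y, |f y| ≤ B) :
    ∫ ω, (alive a x ξ n).indicator (fun ω => f (chain a x (fun k => ξ k ω) n)) ω ∂P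
      = (killed a p)^[n] f x := by
  induction n generalizing f with
  | zero =>
    have : alive a x ξ 0 = univ := by
      ext ω; simp [alive, chain, hx]
    simp [this, chain]
  | succ n ih =>
    set X : Ω → ℝ := fun ω => chain a x (fun k => ξ k ω) n with hX
    set f₁ : ℝ → ℝ := fun y => f (a * y + 1) with hf₁
    set f₂ : ℝ → ℝ := fun y => if 1 ≤ a * y then f (a * y - 1) else 0 with hf₂
    have hf₁m : Measurable f₁ := hf.comp (by fun_prop)
    have hf₂m : Measurable f₂ :=
      Measurable.ite (measurableSet_le measurable_const (by fun_prop))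
        (hf.comp (by fun_prop)) measurable_const
    have hB0 : 0 ≤ B := (abs_nonneg _).trans (hB 0)
    have hf₁B : ∀ y, |f₁ y| ≤ B := fun y => hB _
    have hf₂B : ∀ y, |f₂ y| ≤ B := fun y => by
      simp only [hf₂]; split_ifs
      exacts [hB _, by simpa using hB0]
    have hG : ∀ {g : ℝ → ℝ}, Measurable g →
        Measurable[history ξ n] ((alive a x ξ n).indicator (fun ω => g (X ω))) := fun hg =>
      (hg.comp (measurable_chain_history n)).indicator (measurableSet_alive_history n)
    have hm := h.measurable (n + 1) (by omega)
    have hone : ∀ c : ℝ, Measurable (({c} : Set ℝ).indicator (1 : ℝ → ℝ)) := fun c =>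
      measurable_one.indicator (measurableSet_singleton c)
    have hprod : ∀ (c : ℝ) {g : ℝ → ℝ}, Measurable g →
        ∫ ω, ({c} : Set ℝ).indicator 1 (ξ (n + 1) ω) *
          (alive a x ξ n).indicator (fun ω => g (X ω)) ω ∂P
        = P.real {ω | ξ (n + 1) ω = c} *
          ∫ ω, (alive a x ξ n).indicator (fun ω => g (X ω)) ω ∂P := by
      intro c g hg
      have hind := (h.indepFun n (hG hg)).comp (hone c) measurable_id
      have h1 := hind.integral_fun_mul_eq_mul_integral
        ((hone c).comp hm).aestronglyMeasurable
        ((hG hg).mono (h.history_le n) le_rfl).aestronglyMeasurable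
      simp only [Function.comp_apply, id] at h1
      rw [h1]
      congr 1
      have h2 : (fun ω => ({c} : Set ℝ).indicator (1 : ℝ → ℝ) (ξ (n + 1) ω))
          = {ω | ξ (n + 1) ω = c}.indicator 1 := by
        ext ω; simp [indicator]
      rw [h2]
      exact integral_indicator_one (μ := P) (hm (measurableSet_singleton c))
    have hint : ∀ (c : ℝ) {g : ℝ → ℝ}, Measurable g → (∀ y, |g y| ≤ B) →
        Integrable (fun ω => ({c} : Set ℝ).indicator 1 (ξ (n + 1) ω) *
          (alive a x ξ n).indicator (fun ω => g (X ω)) ω) P := by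
      intro c g hg hgB
      refine Integrable.of_bound (((hone c).comp hm).mul
        ((hG hg).mono (h.history_le n) le_rfl)).aestronglyMeasurable B
        (Eventually.of_forall fun ω => ?_)
      rw [Real.norm_eq_abs, abs_mul]
      have h1 : |({c} : Set ℝ).indicator (1 : ℝ → ℝ) (ξ (n + 1) ω)| ≤ 1 := by
        unfold indicator; split_ifs <;> simp
      have h2 : |(alive a x ξ n).indicator (fun ω => g (X ω)) ω| ≤ B := by
        unfold indicator; split_ifs
        exacts [hgB _, by simpa using hB0]
      nlinarith [abs_nonneg ((alive a x ξ n).indicator (fun ω => g (X ω)) ω)]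
    have hstep : ∀ ω, ω ∈ alive a x ξ (n + 1) ↔
        ω ∈ alive a x ξ n ∧ 0 ≤ a * X ω + ξ (n + 1) ω := fun ω => by
      refine ⟨fun h => ⟨fun k hk => h k (by omega), h (n + 1) le_rfl⟩, fun h k hk => ?_⟩
      rcases Nat.le_succ_iff.1 hk with hk | rfl
      exacts [h.1 k hk, h.2]
    -- The last step is removed by splitting on the value of ξ_{n+1}. This replaces f by f₁ and f₂,
    -- whose combination p f₁ + (1-p) f₂ is `killed a p f`; hence the induction over all f.
    have hae : (alive a x ξ (n + 1)).indicator (fun ω => f (chain a x (fun k => ξ k ω) (n + 1)))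
        =ᵐ[P] fun ω => ({1} : Set ℝ).indicator 1 (ξ (n + 1) ω) *
            (alive a x ξ n).indicator (fun ω => f₁ (X ω)) ω
          + ({-1} : Set ℝ).indicator 1 (ξ (n + 1) ω) *
            (alive a x ξ n).indicator (fun ω => f₂ (X ω)) ω := by
      filter_upwards [h.ae_eq_one_or hp hp' n] with ω hω
      have hc : chain a x (fun k => ξ k ω) (n + 1) = a * X ω + ξ (n + 1) ω := rfl
      have hs := hstep ω
      by_cases hA : ω ∈ alive a x ξ n
      · have hX0 : 0 ≤ a * X ω := mul_nonneg ha (hA n le_rfl)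
        rcases hω with hω | hω
        · have hS : ω ∈ alive a x ξ (n + 1) := hs.2 ⟨hA, by rw [hω]; linarith⟩
          have h2 : ¬ (1 : ℝ) = -1 := by norm_num
          simp [hω, hA, hS, hc, h2, hf₁]
        · have h2 : ¬ (-1 : ℝ) = 1 := by norm_num
          by_cases h3 : 1 ≤ a * X ω
          · have hS : ω ∈ alive a x ξ (n + 1) := hs.2 ⟨hA, by rw [hω]; linarith⟩
            simp [hω, hA, hS, hc, h2, h3, hf₂, sub_eq_add_neg]
          · have hS : ω ∉ alive a x ξ (n + 1) := fun h => h3 (by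
              have := (hs.1 h).2
              rw [hω] at this; linarith)
            simp [hω, hA, hS, h2, h3, hf₂]
      · have hS : ω ∉ alive a x ξ (n + 1) := fun h => hA (hs.1 h).1
        simp [hA, hS]
    rw [integral_congr_ae hae, integral_add (hint 1 hf₁m hf₁B) (hint (-1) hf₂m hf₂B),
      hprod 1 hf₁m, hprod (-1) hf₂m, ih hf₁m hf₁B, ih hf₂m hf₂B, measureReal_def, measureReal_def,
      h.prob_one _ (by omega), h.prob_neg_one _ (by omega), ENNReal.toReal_ofReal hp,
      ENNReal.toReal_ofReal (by linarith), Function.iterate_succ_apply]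
    exact (congrFun (killed_iterate_linear n p (1 - p) f₁ f₂) x).symm

end Probability

end

/-! ### Conditional law given survival, and conclusion -/

section

variable {a p x : ℝ}

section ConditionalLaw

variable {Ω : Type*} [MeasurableSpace Ω] {P : Measure Ω} {ξ : ℕ → Ω → ℝ}

theorem IsInnovation.measurable_chain (h : IsInnovation P p ξ) (n : ℕ) :
    Measurable fun ω => chain a x (fun k => ξ k ω) n :=
  (measurable_chain_history n).mono (h.history_le n) le_rfl

theorem IsInnovation.measurableSet_alive (h : IsInnovation P p ξ) (n : ℕ) :
    MeasurableSet (alive a x ξ n) :=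
  h.history_le n _ (measurableSet_alive_history n)

/-- The law of `X_n` conditionally on survival up to time `n`. -/
def condLaw (P : Measure Ω) (a x : ℝ) (ξ : ℕ → Ω → ℝ) (n : ℕ) : Measure ℝ :=
  (P[|alive a x ξ n]).map fun ω => chain a x (fun k => ξ k ω) n

variable [IsProbabilityMeasure P]

theorem IsInnovation.measureReal_alive_inter (h : IsInnovation P p ξ) (ha : 0 ≤ a) (hp : 0 ≤ p)
    (hp' : p ≤ 1) (hx : 0 ≤ x) (n : ℕ) {s : Set ℝ} (hs : MeasurableSet s) :
    P.real (alive a x ξ n ∩ (fun ω => chain a x (fun k => ξ k ω) n) ⁻¹' s)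
      = (killed a p)^[n] (s.indicator 1) x := by
  rw [← h.integral_alive ha hp hp' hx n (measurable_one.indicator hs) (B := 1)
    (fun y => by unfold indicator; split_ifs <;> simp),
    ← integral_indicator_one ((h.measurableSet_alive n).inter (h.measurable_chain n hs))]
  congr 1
  ext ω
  by_cases h1 : ω ∈ alive a x ξ n <;> by_cases h2 : chain a x (fun k => ξ k ω) n ∈ s <;>
    simp [indicator, h1, h2]

theorem IsInnovation.measureReal_alive (h : IsInnovation P p ξ) (ha : 0 ≤ a) (hp : 0 ≤ p)
    (hp' : p ≤ 1) (hx : 0 ≤ x) (n : ℕ) : P.real (alive a x ξ n) = survival a p n x := by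
  have := h.measureReal_alive_inter ha hp hp' hx n MeasurableSet.univ
  simpa [survival, Pi.one_def] using this

theorem IsInnovation.isProbabilityMeasure_cond (h : IsInnovation P p ξ) (ha : 0 ≤ a) (hp : 0 < p)
    (hp' : p ≤ 1) (hx : 0 ≤ x) (n : ℕ) : IsProbabilityMeasure (P[|alive a x ξ n]) := by
  refine cond_isProbabilityMeasure fun h0 => ?_
  have h1 := h.measureReal_alive ha hp.le hp' hx n
  rw [measureReal_def, h0, ENNReal.toReal_zero] at h1
  exact (survival_pos hp hp' n x).ne h1

theorem IsInnovation.condLaw_real (h : IsInnovation P p ξ) (ha : 0 ≤ a) (hp : 0 ≤ p)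
    (hp' : p ≤ 1) (hx : 0 ≤ x) (n : ℕ) {s : Set ℝ} (hs : MeasurableSet s) :
    (condLaw P a x ξ n).real s = (killed a p)^[n] (s.indicator 1) x / survival a p n x := by
  rw [condLaw, map_measureReal_apply (h.measurable_chain n) hs,
    measureReal_def, cond_apply (h.measurableSet_alive n), ENNReal.toReal_mul, ENNReal.toReal_inv,
    ← measureReal_def, ← measureReal_def, h.measureReal_alive ha hp hp' hx,
    h.measureReal_alive_inter ha hp hp' hx n hs, inv_mul_eq_div]

theorem IsInnovation.condLaw_compl (h : IsInnovation P p ξ) (ha : 0 ≤ a) (ha1 : a < 1)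
    (hp : 0 < p) (hp' : p ≤ 1) (hx : x ∈ stateSpace a) (n : ℕ) :
    condLaw P a x ξ n (stateSpace a)ᶜ = 0 := by
  have := h.isProbabilityMeasure_cond ha hp hp' hx.1 n
  have hprob : IsProbabilityMeasure (condLaw P a x ξ n) :=
    Measure.isProbabilityMeasure_map (h.measurable_chain n).aemeasurable
  have hS : MeasurableSet (stateSpace a)ᶜ := measurableSet_Icc.compl
  rw [← measureReal_eq_zero_iff, h.condLaw_real ha hp.le hp' hx.1 n hS]
  have h0 : (killed a p)^[n] (fun _ => 0) = fun _ => 0 := by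
    simpa using killed_iterate_linear (a := a) (p := p) n 0 0 (fun _ => 0) (fun _ => 0)
  have h1 : EqOn ((stateSpace a)ᶜ.indicator (1 : ℝ → ℝ)) (fun _ => 0) (stateSpace a) := fun z hz =>
    indicator_of_notMem (not_not.2 hz) _
  rw [killed_iterate_congr ha ha1 n h1 hx, h0, zero_div]

end ConditionalLaw

end

end ARPersist

end

theorem mainTheorem4 (a p : ℝ) (ha : 1 / 2 < a) (ha' : a ≤ 2 / 3) (hp : 0 < p) (hp' : p < 1) :
    ∃ lam : ℝ, (ARPersist.IsRate a p lam ∧ ∀ l : ℝ, ARPersist.IsRate a p l → l = lam) ∧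
    ∃ ν : Measure ℝ, ARPersist.IsLimitLaw a p lam ν ∧
    ∃ C γ : ℝ, 0 < C ∧ 0 < γ ∧ γ < 1 ∧
      ∀ (Ω : Type*) [MeasurableSpace Ω] (P : Measure Ω) [IsProbabilityMeasure P]
        (ξ : ℕ → Ω → ℝ), ARPersist.IsInnovation P p ξ →
      ∀ f : ℝ → ℝ, BoundedVariationOn f (ARPersist.stateSpace a) →
      ∀ x ∈ ARPersist.stateSpace a, ∀ n : ℕ,
        |(∫ ω, f (ARPersist.chain a x (fun k => ξ k ω) n)
              ∂(P[|{ω | (n : ℕ∞) < ARPersist.exitTime a x (fun k => ξ k ω)}]))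
            - ∫ z in ARPersist.stateSpace a, f z ∂ν|
          ≤ C * γ ^ n * (eVariationOn f (ARPersist.stateSpace a)).toReal := by
  have ha0 : 0 ≤ a := by linarith
  have ha1 : a < 1 := by linarith
  obtain ⟨lam, hlam, ν, hν, K, γ, hK, hγ, hγ1, hconv⟩ :=
    ARPersist.exists_limitLaw ha ha' hp hp'
  refine ⟨lam, ⟨hlam, fun l hl => hl.unique hp hp' hlam⟩, ν, hν, 3 * K, γ, by positivity, hγ, hγ1,
    ?_⟩
  intro Ω _ P _ ξ hξ f hf x hx n
  have hνp := hν.prob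
  have hcond := hξ.isProbabilityMeasure_cond ha0 hp hp'.le hx.1 n
  have hchain : Measurable fun ω => ARPersist.chain a x (fun k => ξ k ω) n :=
    hξ.measurable_chain n
  have hlaw : IsProbabilityMeasure (ARPersist.condLaw P a x ξ n) :=
    Measure.isProbabilityMeasure_map hchain.aemeasurable
  have hM : (0 : ℝ) ≤ 1 / (1 - a) := one_div_nonneg.2 (by linarith)
  have halive : {ω | (n : ℕ∞) < ARPersist.exitTime a x (fun k => ξ k ω)}
      = ARPersist.alive a x ξ n := by
    ext ω
    exact ARPersist.lt_exitTime_iff _ n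
  -- Nothing is assumed about f outside the state space. Composing with the projection gives a
  -- globally measurable function equal to f almost everywhere for both laws, as `integral_map`
  -- requires.
  have hproj : ∀ z ∈ ARPersist.stateSpace a, f z = f (projIcc 0 (1 / (1 - a)) hM z) :=
    fun z hz => by rw [projIcc_of_mem hM hz]
  have hcompl := hξ.condLaw_compl ha0 ha1 hp hp'.le hx n
  obtain ⟨hmeas, hbound⟩ := ARPersist.abs_integral_sub_le_of_boundedVariationOn
    (μ := ARPersist.condLaw P a x ξ n) (ν := ν) (ε := K * γ ^ n) hM (fun y => by
      rw [hξ.condLaw_real ha0 hp.le hp'.le hx.1 n measurableSet_Ioi]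
      exact hconv x hx y n) hf
  have hleft : ∫ ω, f (ARPersist.chain a x (fun k => ξ k ω) n) ∂(P[|ARPersist.alive a x ξ n])
      = ∫ z, f (projIcc 0 (1 / (1 - a)) hM z) ∂(ARPersist.condLaw P a x ξ n) := by
    rw [ARPersist.condLaw, integral_map hchain.aemeasurable hmeas.aestronglyMeasurable]
    refine integral_congr_ae ?_
    have h1 : ∀ᵐ z ∂(ARPersist.condLaw P a x ξ n), z ∈ ARPersist.stateSpace a := hcompl
    filter_upwards [ae_of_ae_map hchain.aemeasurable h1] with ω hω
    exact hproj _ hω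
  have hright : ∫ z in ARPersist.stateSpace a, f z ∂ν
      = ∫ z, f (projIcc 0 (1 / (1 - a)) hM z) ∂ν := by
    have h1 : ∀ᵐ z ∂ν, z ∈ ARPersist.stateSpace a := hν.carrier
    rw [Measure.restrict_eq_self_of_ae_mem h1]
    refine integral_congr_ae ?_
    filter_upwards [h1] with z hz
    exact hproj z hz
  rw [halive, hleft, hright]
  refine hbound.trans (le_of_eq ?_)
  rw [ARPersist.stateSpace]
  ring
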